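/- Let $X$ be a compact connected complex manifold with a very ample line bundle $L=\mathcal O_X(1)$ (i.e. a polarised smooth projective variety), $h_L$ a smooth hermitian metric on $L$, $\mathcal E$ a holomorphic vector bundle of rank $r$ on $X$ with underlying smooth bundle $E$ and a smooth reference hermitian metric $h_{\mathrm{ref}}$, and $k\in\mathbb Z$ such that $\mathcal E$ is $k$-regular, with quotient map $\rho:H^0(\mathcal E(k))\otimes\mathcal O_X(-k)\to\mathcal E$. Fix a basis $\mathbb S=\{s_1,\dots,s_N\}$ of $H^0(\mathcal E(k))$ and the hermitian form on $H^0(\mathcal E(k))$ for which it is orthonormal. Using the metric dualities $H^0(\mathcal E(k))\cong\overline{H^0(\mathcal E(k))^\vee}$, $E\cong\overline{E^\vee}$ (given by $h_{\mathrm{ref}}$) and the duality given by $h_L$, regard $\rho$ as a fibrewise map $\overline{H^0(\mathcal E(k))^\vee}\to\overline{E^\vee}$ (with $L_x$ trivialised by a unit vector), put $Q^*=f\circ\rho$ for a smooth fibrewise invertible gauge transformation $f$ (for $f=\mathrm{id}$, $Q$ is the matrix expressing the $s_i$ in an orthonormal frame), and let $Q$ be its hermitian adjoint. Let $\zeta\in\mathfrak{sl}(H^0(\mathcal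 E(k))^\vee)$ be hermitian with rational eigenvalues $w_1>\dots>w_\nu$, $\sigma_t=e^{\zeta t}$, and let $h_{\sigma_t}=Q^*\sigma_t^*\sigma_tQ$ be the Fubini–Study metrics along the associated Bergman 1-parameter subgroup. Let $H^0(\mathcal E(k))=\bigoplus_jV_{w_j}$ be the weight decomposition obtained from $\zeta$ by metric duality, $\mathcal E_{\le-w_i}\subset\mathcal E$ the image under $\rho$ of $\bigoplus_{j\le i}V_{w_j}\otimes\mathcal O_X(-k)$ (with $\mathcal E_{\le -w_0}=0$), and $X^{reg}$ the set of points at which all the sheaves $\mathcal E_{\le-w_i}$ and $\mathcal E/\mathcal E_{\le-w_i}$ are locally free. Over $X^{reg}$ put $E_{-w_i}=E_{\le-w_i}/E_{\le-w_{i-1}}$, and let $\hat1<\dots<\hat\nu$ be the indices $\alpha$ for which $E_{-w_\alpha}$ has positive rank. Fix a smooth splitting of the filtration, i.e. a smooth isomorphism $E\cong\bigoplus_{\alpha=\hat1}^{\hat\nu}E_{-w_\alpha}$ over $X^{reg}$ which on each $E_{\le -w_\alpha}$ has zero components of index $>\alpha$ and has the quotient map as its component of index $\alpha$; via $f$ and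 $h_{\mathrm{ref}}$ it induces an isomorphism $\overline{E^\vee}\cong\bigoplus_\alpha E_{-w_\alpha}$ with projections $\mathrm{pr}_\alpha$. Let $Q^*_{j\to\alpha}=\mathrm{pr}_\alpha\circ Q^*|_{V_{w_j}}$ (extended by zero to the other weight spaces), let $Q_{\alpha\to j}$ be its hermitian conjugate, and let $e^{wt}=\mathrm{diag}(e^{w_{\hat1}t},\dots,e^{w_{\hat\nu}t})$ with respect to this decomposition; gauge transformations $g$ act on hermitian forms by $h\mapsto g\,h\,g^*$, and $e^{wt}h\,e^{wt}$ is understood in this sense. Then over $X^{reg}$ one has $h_{\sigma_t}=e^{wt}\,\hat h_{\sigma_t}\,e^{wt}$, where $\hat h_{\sigma_t}:=e^{-wt}h_{\sigma_t}e^{-wt}$ satisfies $$\hat h_{\sigma_t}=\bigoplus_{\alpha=\hat1}^{\hat\nu}Q^*_{\alpha\to\alpha}Q_{\alpha\to\alpha}+\bar I_{\sigma_t},$$ and $\bar I_{\sigma_t}$ is the hermitian form whose $(\alpha,\beta)$-block is $$\sum_{\substack{j\ge\alpha,\ j\ge\beta\\ (\alpha,\beta)\ne(j,j)}}e^{-(w_\alpha-w_j)t}e^{-(w_\beta-w_j)t}\,Q^*_{j\to\alpha}Q_{\beta\to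 j}.$$ The forms $\hat h_{\sigma_t}$ and $\hat h:=\bigoplus_\alpha Q^*_{\alpha\to\alpha}Q_{\alpha\to\alpha}$ are smooth on $X^{reg}$. If $\delta\le w_i-w_j$ for all $i<j$, then $\bar I_{\sigma_t}$ decays like $e^{-\delta t}$ as $t\to+\infty$, locally uniformly on $X^{reg}$ together with all its derivatives. Hence $\hat h_{\sigma_t}$ converges to $\hat h$ (the renormalised Quot-scheme limit) as $t\to+\infty$, and $\hat h$ is a positive definite hermitian form at every point of $X^{reg}$. -/

import Mathlib

open scoped Manifold ContDiff Topology
open Bundle Filter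

universe u

set_option linter.unusedSectionVars false
set_option linter.unusedVariables false

namespace QuotFS

noncomputable section

/-! ### Holomorphic and smooth sections -/

section Sections

variable (n : ℕ) {X : Type u} [TopologicalSpace X] [ChartedSpace (EuclideanSpace ℂ (Fin n)) X]

/-- `s` is a holomorphic section over the open set `U` of the holomorphic vector bundle `E` with
model fibre `F`. -/
def IsHolOn (F : Type) [NormedAddCommGroup F] [NormedSpace ℂ F] (E : X → Type u)
    [TopologicalSpace (TotalSpace F E)] [∀ x, TopologicalSpace (E x)] [FiberBundle F E]
    (s : ∀ x, E x) (U : Set X) : Prop :=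
  ContMDiffOn 𝓘(ℂ, EuclideanSpace ℂ (Fin n)) (𝓘(ℂ, EuclideanSpace ℂ (Fin n)).prod 𝓘(ℂ, F)) ω
    (fun x => TotalSpace.mk' F x (s x)) U

/-- `s` is a (real) `C^∞` section over the open set `U` of the complex vector bundle `E`. -/
def IsSmoothOn (F : Type) [NormedAddCommGroup F] [NormedSpace ℂ F] (E : X → Type u)
    [TopologicalSpace (TotalSpace F E)] [∀ x, TopologicalSpace (E x)] [FiberBundle F E]
    (s : ∀ x, E x) (U : Set X) : Prop :=
  ContMDiffOn 𝓘(ℝ, EuclideanSpace ℂ (Fin n)) (𝓘(ℝ, EuclideanSpace ℂ (Fin n)).prod 𝓘(ℝ, F)) ∞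
    (fun x => TotalSpace.mk' F x (s x)) U

/-- The given fibrewise inner products form a `C^∞` hermitian metric on `E`. -/
def IsSmoothMetric (F : Type) [NormedAddCommGroup F] [NormedSpace ℂ F] (E : X → Type u)
    [TopologicalSpace (TotalSpace F E)] [∀ x, NormedAddCommGroup (E x)]
    [∀ x, InnerProductSpace ℂ (E x)] [FiberBundle F E] : Prop :=
  ∀ U : Set X, IsOpen U → ∀ u v : ∀ x, E x, IsSmoothOn n F E u U → IsSmoothOn n F E v U →
    ContMDiffOn 𝓘(ℝ, EuclideanSpace ℂ (Fin n)) 𝓘(ℝ, ℂ) ∞ (fun x => inner ℂ (u x) (v x)) U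

/-- The field of endomorphisms `A` of `E` is `C^∞` over `U`. -/
def IsSmoothEndOn (F : Type) [NormedAddCommGroup F] [NormedSpace ℂ F] (E : X → Type u)
    [TopologicalSpace (TotalSpace F E)] [∀ x, NormedAddCommGroup (E x)]
    [∀ x, InnerProductSpace ℂ (E x)] [FiberBundle F E]
    (A : ∀ x, E x →ₗ[ℂ] E x) (U : Set X) : Prop :=
  ∀ W : Set X, IsOpen W → W ⊆ U → ∀ u : ∀ x, E x, IsSmoothOn n F E u W →
    IsSmoothOn n F E (fun x => A x (u x)) W

/-- The `t`-dependent functions `g t` decay like `exp (-c t)` as `t → ∞`, together with all their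
derivatives and locally uniformly, over the open set `U`. -/
def DecaysOn (c : ℝ) (g : ℝ → X → ℂ) (U : Set X) : Prop :=
  ∀ x₀ ∈ U, ∀ m : ℕ, ∃ C : ℝ, ∀ᶠ x in 𝓝 x₀, ∀ t : ℝ, 0 ≤ t →
    ‖iteratedFDeriv ℝ m (g t ∘ (chartAt (EuclideanSpace ℂ (Fin n)) x₀).symm)
      (chartAt (EuclideanSpace ℂ (Fin n)) x₀ x)‖ ≤ C * Real.exp (-c * t)

/-- A holomorphic line bundle is very ample if its global holomorphic sections have no base point,
separate points and separate tangent vectors. -/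
def VeryAmple (L : X → Type u) [TopologicalSpace (TotalSpace ℂ L)]
    [∀ x, NormedAddCommGroup (L x)] [∀ x, InnerProductSpace ℂ (L x)] [FiberBundle ℂ L] : Prop :=
  (∀ x : X, ∃ s : ∀ x, L x, IsHolOn n ℂ L s Set.univ ∧ s x ≠ 0) ∧
  (∀ x y : X, x ≠ y → ∃ s : ∀ x, L x, IsHolOn n ℂ L s Set.univ ∧ s x = 0 ∧ s y ≠ 0) ∧
  (∀ (x : X) (v : TangentSpace 𝓘(ℂ, EuclideanSpace ℂ (Fin n)) x), v ≠ 0 →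
    ∃ s : ∀ x, L x, IsHolOn n ℂ L s Set.univ ∧ s x = 0 ∧
      mfderiv 𝓘(ℂ, EuclideanSpace ℂ (Fin n)) 𝓘(ℂ, ℂ)
        (fun y => (trivializationAt ℂ L x (TotalSpace.mk' ℂ y (s y))).2) x v ≠ 0)

end Sections

/-! ### The twists `E(k) = E ⊗ L^k` -/

section Twist

variable (n r : ℕ) {X : Type u} [TopologicalSpace X] [ChartedSpace (EuclideanSpace ℂ (Fin n)) X]
  (E : X → Type u) [TopologicalSpace (TotalSpace (EuclideanSpace ℂ (Fin r)) E)]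
  [∀ x, NormedAddCommGroup (E x)] [∀ x, InnerProductSpace ℂ (E x)]
  [FiberBundle (EuclideanSpace ℂ (Fin r)) E]
  [VectorBundle ℂ (EuclideanSpace ℂ (Fin r)) E]
  (L : X → Type u) [TopologicalSpace (TotalSpace ℂ L)]
  [∀ x, NormedAddCommGroup (L x)] [∀ x, InnerProductSpace ℂ (L x)] [FiberBundle ℂ L]

/-- The fibre at `x` of `E(k) = E ⊗ L^k` (`k : ℤ`) is the space of maps `φ : L_x ∖ {0} → E_x` which
are homogeneous of degree `-k`; the map corresponding to `e ⊗ ℓ₀^k` is `ℓ ↦ (ℓ₀ / ℓ)^k e`. By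
convention `φ` is extended by `φ 0 = 0`. -/
def IsTwistedVector (k : ℤ) (x : X) (φ : L x → E x) : Prop :=
  φ 0 = 0 ∧ ∀ (c : ℂ) (ℓ : L x), c ≠ 0 → φ (c • ℓ) = c ^ (-k) • φ ℓ

/-- `s` is a holomorphic section of `E(k)` over the open set `U`: it takes values in `E(k)`, and for
every nowhere vanishing holomorphic local section `ℓ` of `L`, the local section `x ↦ s x (ℓ x)` of
`E` (the contraction of `s` with `ℓ^(-k)`) is holomorphic. -/
def IsTwistedHolOn (k : ℤ) (s : ∀ x, L x → E x) (U : Set X) : Prop :=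
  (∀ x ∈ U, IsTwistedVector E L k x (s x)) ∧
  ∀ W : Set X, IsOpen W → W ⊆ U → ∀ ℓ : ∀ x, L x, IsHolOn n ℂ L ℓ W → (∀ x ∈ W, ℓ x ≠ 0) →
    IsHolOn n (EuclideanSpace ℂ (Fin r)) E (fun x => s x (ℓ x)) W

variable {n r E L}

lemma IsTwistedHolOn.add {k : ℤ} {s s' : ∀ x, L x → E x} {U : Set X}
    (h : IsTwistedHolOn n r E L k s U) (h' : IsTwistedHolOn n r E L k s' U) :
    IsTwistedHolOn n r E L k (s + s') U := by
  refine ⟨fun x hx => ⟨by simp [(h.1 x hx).1, (h'.1 x hx).1], fun c ℓ hc => ?_⟩,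
    fun W hW hWU ℓ hℓ h0 => ?_⟩
  · simp [(h.1 x hx).2 c ℓ hc, (h'.1 x hx).2 c ℓ hc]
  · exact ContMDiffOn.add_section (h.2 W hW hWU ℓ hℓ h0) (h'.2 W hW hWU ℓ hℓ h0)

lemma IsTwistedHolOn.smul {k : ℤ} {s : ∀ x, L x → E x} {U : Set X} (a : ℂ)
    (h : IsTwistedHolOn n r E L k s U) : IsTwistedHolOn n r E L k (a • s) U := by
  refine ⟨fun x hx => ⟨by simp [(h.1 x hx).1], fun c ℓ hc => ?_⟩, fun W hW hWU ℓ hℓ h0 => ?_⟩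
  · simp [(h.1 x hx).2 c ℓ hc, smul_comm a]
  · exact ContMDiffOn.const_smul_section (h.2 W hW hWU ℓ hℓ h0)

lemma IsTwistedHolOn.zero (k : ℤ) (U : Set X) :
    IsTwistedHolOn n r E L k (0 : ∀ x, L x → E x) U := by
  refine ⟨fun x _ => ⟨rfl, fun c ℓ _ => by simp⟩, fun W _ _ ℓ _ _ => ?_⟩
  exact (contMDiff_zeroSection ℂ E).contMDiffOn

lemma IsTwistedHolOn.mono {k : ℤ} {s : ∀ x, L x → E x} {U V : Set X} (hVU : V ⊆ U)
    (h : IsTwistedHolOn n r E L k s U) : IsTwistedHolOn n r E L k s V :=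
  ⟨fun x hx => h.1 x (hVU hx), fun W hW hWV => h.2 W hW (hWV.trans hVU)⟩

lemma IsTwistedHolOn.congr {k : ℤ} {s s' : ∀ x, L x → E x} {U : Set X}
    (h : IsTwistedHolOn n r E L k s U) (hs : ∀ x ∈ U, s' x = s x) : IsTwistedHolOn n r E L k s' U := by
  refine ⟨fun x hx => by rw [hs x hx]; exact h.1 x hx, fun W hW hWU ℓ hℓ h0 => ?_⟩
  exact (h.2 W hW hWU ℓ hℓ h0).congr fun x hx => by simp [hs x (hWU hx)]

lemma IsTwistedHolOn.of_locally {k : ℤ} {s : ∀ x, L x → E x} {U : Set X}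
    (h : ∀ x ∈ U, ∃ V : Set X, IsOpen V ∧ x ∈ V ∧ IsTwistedHolOn n r E L k s V) :
    IsTwistedHolOn n r E L k s U := by
  refine ⟨fun x hx => ?_, fun W hW hWU ℓ hℓ h0 x hx => ?_⟩
  · obtain ⟨V, -, hxV, hV⟩ := h x hx
    exact hV.1 x hxV
  · obtain ⟨V, hVo, hxV, hV⟩ := h x (hWU hx)
    have h1 := hV.2 (W ∩ V) (hW.inter hVo) Set.inter_subset_right ℓ
      (ContMDiffOn.mono hℓ Set.inter_subset_left) (fun y hy => h0 y hy.1)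
    exact ((h1 x ⟨hx, hxV⟩).contMDiffAt ((hW.inter hVo).mem_nhds ⟨hx, hxV⟩)).contMDiffWithinAt

variable (n r E L)

/-- `H⁰(E(k))`, the space of global holomorphic sections of `E(k)`. -/
def H0 (k : ℤ) : Submodule ℂ (∀ x, L x → E x) where
  carrier := {s | IsTwistedHolOn n r E L k s Set.univ}
  add_mem' h h' := h.add h'
  zero_mem' := IsTwistedHolOn.zero k _
  smul_mem' a _ h := h.smul a

open Classical in
/-- Extension by zero of a section over `U`. -/
def extend {U : Set X} (s : ∀ x : U, L x → E x) : ∀ x, L x → E x :=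
  fun x => if h : x ∈ U then s ⟨x, h⟩ else 0

lemma extend_apply {U : Set X} (s : ∀ x : U, L x → E x) {x : X} (hx : x ∈ U) :
    extend E L s x = s ⟨x, hx⟩ := dif_pos hx

open TopologicalSpace in
/-- Being a holomorphic section of `E(k)` is a local condition. -/
def twistLocalPredicate (k : ℤ) :
    TopCat.LocalPredicate (X := TopCat.of X) (fun x : X => L x → E x) where
  pred {U} s := IsTwistedHolOn n r E L k (extend E L (U := (U : Set X)) s) (U : Set X)
  res {U V} i s h := by
    refine (h.mono i.le).congr fun x hx => ?_
    rw [extend_apply E L _ hx, extend_apply E L _ (i.le hx)]; rfl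
  locality {U} s h := by
    refine IsTwistedHolOn.of_locally fun x hx => ?_
    obtain ⟨V, hxV, i, hV⟩ := h ⟨x, hx⟩
    refine ⟨(V : Set X), V.isOpen, hxV, hV.congr fun y hy => ?_⟩
    rw [extend_apply E L _ hy, extend_apply E L _ (i.le hy)]; rfl

open TopologicalSpace in
/-- The group of holomorphic sections of `E(k)` over the open set `U`. -/
def twistSections (k : ℤ) (U : Opens X) : AddSubgroup (∀ x : U, L x → E x) where
  carrier := {s | IsTwistedHolOn n r E L k (extend E L (U := (U : Set X)) s) (U : Set X)}
  add_mem' {s s'} h h' := (h.add h').congr fun x hx => by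
    simp only [Pi.add_apply]
    rw [extend_apply E L _ hx, extend_apply E L _ hx, extend_apply E L _ hx]; rfl
  zero_mem' := (IsTwistedHolOn.zero k _).congr fun x hx => extend_apply E L _ hx
  neg_mem' {s} h := (h.smul (-1)).congr fun x hx => by
    simp only [Pi.smul_apply]
    rw [extend_apply E L _ hx, extend_apply E L _ hx, neg_one_smul]; rfl

open TopologicalSpace CategoryTheory in
/-- The presheaf of holomorphic sections of `E(k)`. -/
def twistPresheaf (k : ℤ) : TopCat.Presheaf AddCommGrpCat.{u} (TopCat.of X) where
  obj U := AddCommGrpCat.of (twistSections n r E L k U.unop)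
  map {U V} i := AddCommGrpCat.ofHom
    { toFun := fun s => ⟨fun x => s.1 ⟨x.1, i.unop.le x.2⟩,
        (twistLocalPredicate n r E L k).res i.unop s.1 s.2⟩
      map_zero' := rfl
      map_add' := fun _ _ => rfl }
  map_id _ := rfl
  map_comp _ _ := rfl

open CategoryTheory in
/-- The sheaf (of abelian groups) of holomorphic sections of `E(k)`. -/
def twistSheaf (k : ℤ) : TopCat.Sheaf AddCommGrpCat.{u} (TopCat.of X) where
  obj := twistPresheaf n r E L k
  property := by
    rw [CategoryTheory.Presheaf.isSheaf_iff_isSheaf_forget _ _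
      (CategoryTheory.forget AddCommGrpCat)]
    exact (TopCat.subsheafToTypes (twistLocalPredicate n r E L k)).property

/-- `E` is `k`-regular: `H^i(E(k - i)) = 0` for all `i > 0`. -/
def IsRegular (k : ℤ) : Prop :=
  ∀ i : ℕ, 0 < i → Subsingleton (CategoryTheory.Sheaf.H (twistSheaf n r E L (k - i)) i)

end Twist
/-! ### Germs and local freeness -/

section Germs

variable (n r : ℕ) {X : Type u} [TopologicalSpace X] [ChartedSpace (EuclideanSpace ℂ (Fin n)) X]

/-- The local ring `𝒪_{X,x}` of germs of holomorphic functions. -/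
def holGerms (x : X) : Subring (Germ (𝓝 x) ℂ) where
  carrier := {g | ∃ f : X → ℂ, ContMDiffAt 𝓘(ℂ, EuclideanSpace ℂ (Fin n)) 𝓘(ℂ, ℂ) ω f x ∧ ↑f = g}
  mul_mem' := by
    rintro _ _ ⟨f, hf, rfl⟩ ⟨g, hg, rfl⟩
    exact ⟨f * g, hf.smul hg, rfl⟩
  one_mem' := ⟨fun _ => 1, contMDiffAt_const, rfl⟩
  add_mem' := by
    rintro _ _ ⟨f, hf, rfl⟩ ⟨g, hg, rfl⟩
    exact ⟨f + g, hf.add hg, rfl⟩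
  zero_mem' := ⟨fun _ => 0, contMDiffAt_const, rfl⟩
  neg_mem' := by
    rintro _ ⟨f, hf, rfl⟩
    exact ⟨-f, hf.neg, rfl⟩

/-- The stalk at `x` of the sheaf of holomorphic sections of a holomorphic vector bundle of rank
`r`; germs of sections are read in the preferred trivialisation at `x`, i.e. as germs of
holomorphic maps to the model fibre. -/
def stalk (x : X) : Submodule (holGerms n x) (Germ (𝓝 x) (EuclideanSpace ℂ (Fin r))) where
  carrier := {g | ∃ f : X → EuclideanSpace ℂ (Fin r),
    ContMDiffAt 𝓘(ℂ, EuclideanSpace ℂ (Fin n)) 𝓘(ℂ, EuclideanSpace ℂ (Fin r)) ω f x ∧ ↑f = g}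
  add_mem' := by
    rintro _ _ ⟨f, hf, rfl⟩ ⟨g, hg, rfl⟩
    exact ⟨f + g, hf.add hg, rfl⟩
  zero_mem' := ⟨fun _ => 0, contMDiffAt_const, rfl⟩
  smul_mem' := by
    rintro ⟨_, f, hf, rfl⟩ _ ⟨g, hg, rfl⟩
    exact ⟨f • g, hf.smul hg, rfl⟩

end Germs

/-! ### Weights, filtration and regular locus -/

section Weights

/-- Let `S` be a basis of `V`, and equip `V` with the hermitian form for which `S` is orthonormal.
Metric duality identifies `V = ℂ^N` with the conjugate of `V^∨`; this is the matrix of the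
endomorphism of `ℂ^N` corresponding to the endomorphism `ζ` of `V^∨` under this identification, the
complex conjugate of the matrix of `ζ` in the dual basis. -/
def weightMatrix {V : Type*} [AddCommGroup V] [Module ℂ V] {N : ℕ}
    (S : Module.Basis (Fin N) ℂ V) (ζ : Module.End ℂ (Module.Dual ℂ V)) :
    Matrix (Fin N) (Fin N) ℂ :=
  (LinearMap.toMatrix S.dualBasis S.dualBasis ζ).map (starRingEnd ℂ)

variable {N ν : ℕ} (Z : Matrix (Fin N) (Fin N) ℂ) (w : Fin ν → ℚ)

/-- The weight space `V_{w_j}`. -/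
def wtSpace (j : Fin ν) : Submodule ℂ (EuclideanSpace ℂ (Fin N)) :=
  Module.End.eigenspace (Matrix.toEuclideanLin Z) (w j : ℂ)

/-- `V_{≤ -w_i} = ⨁_{j ≤ i} V_{w_j}`. -/
def wtLE (i : Fin ν) : Submodule ℂ (EuclideanSpace ℂ (Fin N)) := ⨆ j ≤ i, wtSpace Z w j

/-- `V_{≤ -w_{i-1}} = ⨁_{j < i} V_{w_j}`. -/
def wtLT (i : Fin ν) : Submodule ℂ (EuclideanSpace ℂ (Fin N)) := ⨆ j < i, wtSpace Z w j

/-- The one-parameter subgroup `σ_t = e^{ζ t}`, acting on `ℂ^N`. -/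
def sigma (t : ℝ) : EuclideanSpace ℂ (Fin N) →ₗ[ℂ] EuclideanSpace ℂ (Fin N) :=
  Matrix.toEuclideanLin (NormedSpace.exp ((t : ℂ) • Z))

/-- The orthogonal projection of `ℂ^N` to the weight space `V_{w_j}`. -/
def wtProj (j : Fin ν) : EuclideanSpace ℂ (Fin N) →ₗ[ℂ] EuclideanSpace ℂ (Fin N) :=
  (wtSpace Z w j).starProjection.toLinearMap

end Weights

section Main

variable {n r : ℕ} {X : Type u} [TopologicalSpace X] [ChartedSpace (EuclideanSpace ℂ (Fin n)) X]
  {E : X → Type u} [TopologicalSpace (TotalSpace (EuclideanSpace ℂ (Fin r)) E)]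
  [∀ x, NormedAddCommGroup (E x)] [∀ x, InnerProductSpace ℂ (E x)]
  [∀ x, FiniteDimensional ℂ (E x)]
  [FiberBundle (EuclideanSpace ℂ (Fin r)) E]
  [VectorBundle ℂ (EuclideanSpace ℂ (Fin r)) E]
  {L : X → Type u} [TopologicalSpace (TotalSpace ℂ L)]
  [∀ x, NormedAddCommGroup (L x)] [∀ x, InnerProductSpace ℂ (L x)] [FiberBundle ℂ L]
  {k : ℤ} {N ν : ℕ} (S : Module.Basis (Fin N) ℂ (H0 n r E L k))
  (Z : Matrix (Fin N) (Fin N) ℂ) (w : Fin ν → ℚ)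

/-- The evaluation map `ρ : H⁰(E(k)) ⊗ L_x^{-k} → E_x`, where `H⁰(E(k)) = ℂ^N` by means of the
basis `S`, and `L_x^{-k} = ℂ` by means of `ℓ ∈ L_x`. -/
def rho (x : X) (ℓ : L x) : EuclideanSpace ℂ (Fin N) →ₗ[ℂ] E x :=
  ∑ i, (EuclideanSpace.proj (𝕜 := ℂ) i).toLinearMap.smulRight ((S i).1 x ℓ)

/-- The stalk at `x` of the subsheaf `ρ(W ⊗ 𝒪(-k)) ⊆ 𝓔` generated by a subspace `W` of
`H⁰(E(k))`: it is spanned by the germs of the sections `ρ(c ⊗ ℓ^{-k})`, with `c ∈ W` and `ℓ` a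
nowhere vanishing holomorphic local section of `L`. -/
def imageStalk (W : Submodule ℂ (EuclideanSpace ℂ (Fin N))) (x : X) :
    Submodule (holGerms n x) (stalk n r x) :=
  Submodule.span (holGerms n x) {g | ∃ c ∈ W, ∃ U : Set X, IsOpen U ∧ x ∈ U ∧ ∃ ℓ : ∀ y, L y,
    IsHolOn n ℂ L ℓ U ∧ (∀ y ∈ U, ℓ y ≠ 0) ∧
    g.1 = ((fun y => (trivializationAt (EuclideanSpace ℂ (Fin r)) E x
      (TotalSpace.mk' (EuclideanSpace ℂ (Fin r)) y (rho S y (ℓ y) c))).2 :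
        X → EuclideanSpace ℂ (Fin r)) : Germ (𝓝 x) (EuclideanSpace ℂ (Fin r)))}

/-- The regular locus `X^reg`: the points at which all the sheaves `𝓔_{≤ -w_i}` and
`𝓔 / 𝓔_{≤ -w_i}` are locally free, i.e. have free stalks. -/
def regLocus : Set X :=
  {x | ∀ i : Fin ν, Module.Free (holGerms n x) (imageStalk S (wtLE Z w i) x) ∧
    Module.Free (holGerms n x) (stalk n r x ⧸ imageStalk S (wtLE Z w i) x)}

variable (e : ∀ x, L x)

/-- The fibre at `x` of `E_{≤ -w_i}` (for `x` in the regular locus; `e x` is a nonzero vector of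
`L_x`, on which the fibre does not depend). -/
def fibLE (i : Fin ν) (x : X) : Submodule ℂ (E x) := (wtLE Z w i).map (rho S x (e x))

/-- The fibre at `x` of `E_{≤ -w_{i-1}}`, with `E_{≤ -w_0} = 0`. -/
def fibLT (i : Fin ν) (x : X) : Submodule ℂ (E x) := (wtLT Z w i).map (rho S x (e x))

/-- The fibre at `x` of `E_{-w_i} = E_{≤ -w_i} / E_{≤ -w_{i-1}}`. -/
abbrev fibGr (i : Fin ν) (x : X) : Type u :=
  fibLE S Z w e i x ⧸ (fibLT S Z w e i x).submoduleOf (fibLE S Z w e i x)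

open Classical in
/-- The set of indices `{1̂, …, ν̂}` for which `E_{-w_α}` has positive rank. -/
def hatSet : Finset (Fin ν) :=
  Finset.univ.filter fun α => ∃ x ∈ regLocus S Z w, 0 < Module.finrank ℂ (fibGr S Z w e α x)

/-- The projection of `E_x` to its `α`-th summand, for a given decomposition of `E_x`
(`x` in the regular locus) as the direct sum of the `E_{-w_α}`. -/
def splitProj (iso : ∀ x ∈ regLocus S Z w, E x ≃ₗ[ℂ] (∀ α : hatSet S Z w e, fibGr S Z w e α x))
    (α : hatSet S Z w e) (x : X) : E x →ₗ[ℂ] E x :=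
  open Classical in
  if hx : x ∈ regLocus S Z w then
    (iso x hx).symm.toLinearMap ∘ₗ LinearMap.single ℂ (fun α : hatSet S Z w e => fibGr S Z w e α x) α
      ∘ₗ LinearMap.proj α ∘ₗ (iso x hx).toLinearMap
  else 0

/-- A `C^∞` isomorphism `E ≅ ⨁_α E_{≤ -w_α} / E_{≤ -w_{α-1}}` over the regular locus which splits
the filtration: on `E_{≤ -w_α}` its components of index `> α` vanish and its component of index `α`
is the quotient map. (It is then determined by its projections to the summands, viewed as subbundles
of `E`, and it is `C^∞` if and only if these are.) -/
structure Splitting where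
  iso : ∀ x ∈ regLocus S Z w, E x ≃ₗ[ℂ] (∀ α : hatSet S Z w e, fibGr S Z w e α x)
  iso_eq_mk : ∀ x hx (α : hatSet S Z w e) (v : fibLE S Z w e α x),
    iso x hx v α = Submodule.Quotient.mk v
  iso_eq_zero : ∀ x hx (α β : hatSet S Z w e), α < β → ∀ v : fibLE S Z w e α x,
    iso x hx v β = 0
  smooth : ∀ α, IsSmoothEndOn n (EuclideanSpace ℂ (Fin r)) E (splitProj S Z w e iso α)
    (regLocus S Z w)

/-! In the following, `f` is a gauge transformation of `E`, and `E` is identified with the conjugate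
of `E^∨` by means of the given hermitian metric on `E`. Likewise `ℂ^N` stands for `H⁰(E(k))` and for
the conjugate of its dual. A hermitian form `h` on `E_x` is represented by the endomorphism `A` with
`h(u, v) = ⟨A u, v⟩`; the star in the formulas for forms is the adjoint. -/

variable (f : ∀ x, E x ≃ₗ[ℂ] E x)

/-- `Q^* = f ∘ ρ`. -/
def Qstar (x : X) : EuclideanSpace ℂ (Fin N) →ₗ[ℂ] E x := (f x).toLinearMap ∘ₗ rho S x (e x)

/-- The Fubini-Study metrics `h_{σ_t} = Q^* σ_t^* σ_t Q` along the Bergman one-parameter subgroup. -/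
def hFS (t : ℝ) (x : X) : E x →ₗ[ℂ] E x :=
  Qstar S e f x ∘ₗ LinearMap.adjoint (sigma Z t) ∘ₗ sigma Z t ∘ₗ LinearMap.adjoint (Qstar S e f x)

variable (Ψ : Splitting S Z w e)

/-- The projection `pr_α` to `E_{-w_α}` in the decomposition induced by `Ψ` and `f`; its target
`E_{-w_α}` is regarded as a subbundle of `E` by the decomposition. -/
def pr (α : hatSet S Z w e) (x : X) : E x →ₗ[ℂ] E x :=
  (f x).toLinearMap ∘ₗ splitProj S Z w e Ψ.iso α x ∘ₗ (f x).symm.toLinearMap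

/-- `Q^*_{j → α}`, the composition of `pr_α` and `Q^*` restricted to `V_{w_j}`; it is extended by
zero to the other weight spaces. -/
def Qs (j : Fin ν) (α : hatSet S Z w e) (x : X) : EuclideanSpace ℂ (Fin N) →ₗ[ℂ] E x :=
  pr S Z w e f Ψ α x ∘ₗ Qstar S e f x ∘ₗ wtProj Z w j

/-- `Q_{α → j}`, the hermitian conjugate of `Q^*_{j → α}`. -/
def Qa (α : hatSet S Z w e) (j : Fin ν) (x : X) : E x →ₗ[ℂ] EuclideanSpace ℂ (Fin N) :=
  LinearMap.adjoint (Qs S Z w e f Ψ j α x)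

/-- The block-diagonal gauge transformation `e^{wt} = diag(e^{w_α t})_α`. -/
def weightGauge (t : ℝ) (x : X) : E x →ₗ[ℂ] E x :=
  ∑ α : hatSet S Z w e, (Real.exp ((w α : ℝ) * t) : ℂ) • pr S Z w e f Ψ α x

/-- The renormalised metrics `e^{-wt} h_{σ_t} e^{-wt}`. A gauge transformation `g` acts on a
hermitian form `h` by `g h g^*`. -/
def hRen (t : ℝ) (x : X) : E x →ₗ[ℂ] E x :=
  weightGauge S Z w e f Ψ (-t) x ∘ₗ hFS S Z e f t x ∘ₗ
    LinearMap.adjoint (weightGauge S Z w e f Ψ (-t) x)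

/-- The block-diagonal form `⨁_α Q^*_{α → α} Q_{α → α}`, the renormalised Quot-scheme limit. -/
def hLim (x : X) : E x →ₗ[ℂ] E x :=
  ∑ α : hatSet S Z w e, Qs S Z w e f Ψ α α x ∘ₗ Qa S Z w e f Ψ α α x

/-- The error term, whose `(α, β)`-block is the sum of
`e^{-(w_α - w_j) t} e^{-(w_β - w_j) t} Q^*_{j → α} Q_{β → j}` over all `j ≥ α, β` which are not equal
to both `α` and `β`. -/
def errTerm (t : ℝ) (x : X) : E x →ₗ[ℂ] E x :=
  ∑ α : hatSet S Z w e, ∑ β : hatSet S Z w e,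
    ∑ j ∈ Finset.univ.filter (fun j : Fin ν => (α.1 ≤ j ∧ β.1 ≤ j) ∧ (α.1 < j ∨ β.1 < j)),
      ((Real.exp (-((w α : ℝ) - w j) * t) * Real.exp (-((w β : ℝ) - w j) * t) : ℝ) : ℂ) •
        (Qs S Z w e f Ψ j α x ∘ₗ Qa S Z w e f Ψ β j x)

end Main
end
end QuotFS

/-!
Decompose `ℂ^N` into the weight spaces `V_{w_j}` of the hermitian generator (`sum_wtProj`). On
`V_{w_j}` the endomorphism `σ_t^* σ_t` is multiplication by `e^{2 w_j t}`, so that the block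
`(α, β)` of `e^{-wt} h_{σ_t} e^{-wt}` is
`∑_j e^{-(w_α - w_j) t} e^{-(w_β - w_j) t} Q^*_{j → α} Q_{β → j}` (`hRen_eq_sum`).

For `j < α` the space `ρ(V_{w_j})` lies in `E_{≤ -w_{α-1}}`, on which the `α`-th component of the
splitting vanishes; thus `Q^*_{j → α} = 0` (`Qs_eq_zero_of_lt`), and only the `j ≥ α, β` contribute.
Those with `j = α = β` have exponent `0` and add up to the limit `ĥ`; for all others the exponent is
at most `-δ t`, where `δ` bounds the gaps between the weights from below
(`hRen_eq_hLim_add_errTerm`, `norm_exp_mul_exp_le`). As the error term is a finite sum of such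
exponentials with coefficients which are smooth and do not depend on `t`, it decays together with
all its derivatives (`decaysOn_sum_mul`).

The limit is positive definite because `ρ(V_{w_α})` spans `E_{≤ -w_α}` modulo `E_{≤ -w_{α-1}}`:
the ranges of the `Q^*_{α → α}` are the summands of the splitting, and they span `E`
(`range_pr_le_range_Qs`, `hLim_posDef`).

For the smoothness of the blocks, note that `Q` depends on the choice of a unit vector in `L_x`,
which need not be continuous in `x`; but the forms `Q^* A Q` do not, and near any point they can be
computed from a nowhere vanishing holomorphic section `ℓ` of `L`, at the cost of the smooth factor
`⟨ℓ, ℓ⟩^k` (`isSmoothEndOn_Qstar_comp_comp_adjoint`). Adjoints and inverses of smooth endomorphisms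
are smooth by Cramer's rule in a local frame (`SmoothAt.of_mulVec_eq`).
-/

namespace QuotFS

/-! ### Smooth functions and smooth sections -/

section SmoothSections

variable {n : ℕ} {X : Type u} [TopologicalSpace X] [ChartedSpace (EuclideanSpace ℂ (Fin n)) X]

/-- `g` is a (real) `C^∞` map to the complex vector space `V` at the point `x`. -/
abbrev SmoothAt (n : ℕ) {X : Type u} [TopologicalSpace X]
    [ChartedSpace (EuclideanSpace ℂ (Fin n)) X] {V : Type*} [NormedAddCommGroup V]
    [NormedSpace ℂ V] (g : X → V) (x : X) : Prop :=
  ContMDiffAt 𝓘(ℝ, EuclideanSpace ℂ (Fin n)) 𝓘(ℝ, V) ∞ g x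

theorem SmoothAt.mul {g h : X → ℂ} {x : X} (hg : SmoothAt n g x) (hh : SmoothAt n h x) :
    SmoothAt n (fun y => g y * h y) x :=
  (contDiff_mul (𝕜 := ℝ) (𝔸 := ℂ)).contDiffAt.comp_contMDiffAt (hg.prodMk_space hh)

theorem SmoothAt.sum {ι : Type*} (s : Finset ι) {g : ι → X → ℂ} {x : X}
    (hg : ∀ i ∈ s, SmoothAt n (g i) x) : SmoothAt n (fun y => ∑ i ∈ s, g i y) x := by
  classical
  induction s using Finset.induction_on with
  | empty => simpa using contMDiffAt_const
  | insert a s ha ih =>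
    simp only [Finset.sum_insert ha]
    exact (hg a (Finset.mem_insert_self _ _)).add
      (ih fun i hi => hg i (Finset.mem_insert_of_mem hi))

theorem SmoothAt.inv {g : X → ℂ} {x : X} (hg : SmoothAt n g x) (h0 : g x ≠ 0) :
    SmoothAt n (fun y => (g y)⁻¹) x :=
  (contDiffAt_inv ℝ h0).comp_contMDiffAt hg

theorem SmoothAt.zpow {g : X → ℂ} {x : X} (hg : SmoothAt n g x) (h0 : g x ≠ 0) (k : ℤ) :
    SmoothAt n (fun y => g y ^ k) x := by
  have hpow : ∀ m : ℕ, SmoothAt n (fun y => g y ^ m) x := fun m =>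
    (contDiff_id.pow m : ContDiff ℝ ∞ fun z : ℂ => z ^ m).contDiffAt.comp_contMDiffAt hg
  obtain ⟨m, rfl | rfl⟩ := k.eq_nat_or_neg
  · simpa using hpow m
  · simpa using (hpow m).inv (pow_ne_zero m h0)

/-- The solution of a linear system depends smoothly on the matrix and the right-hand side; this is
Cramer's rule. -/
theorem SmoothAt.of_mulVec_eq {ι : Type} [Fintype ι] [DecidableEq ι] {M : X → Matrix ι ι ℂ}
    {c d : X → ι → ℂ} {x : X} (hM : ∀ i j, SmoothAt n (fun y => M y i j) x)
    (hd : ∀ i, SmoothAt n (fun y => d y i) x) (hdet : (M x).det ≠ 0)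
    (h : ∀ᶠ y in 𝓝 x, (M y).mulVec (c y) = d y) (i : ι) : SmoothAt n (fun y => c y i) x := by
  have hdetS : ∀ A : X → Matrix ι ι ℂ, (∀ i j, SmoothAt n (fun y => A y i j) x) →
      SmoothAt n (fun y => (A y).det) x := by
    intro A hA
    have hA' : ContMDiffAt 𝓘(ℝ, EuclideanSpace ℂ (Fin n)) 𝓘(ℝ, ι → ι → ℂ) ∞
        (fun y i j => A y i j) x :=
      contMDiffAt_pi_space.2 fun i => contMDiffAt_pi_space.2 fun j => hA i j
    have hdetC : ContDiff ℝ ∞ fun B : ι → ι → ℂ => Matrix.det (Matrix.of B) := by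
      simp only [Matrix.det_apply]
      refine ContDiff.sum fun σ _ => ContDiff.const_smul _ (contDiff_prod fun i _ => ?_)
      exact contDiff_apply_apply ℝ ℂ (σ i) i
    exact hdetC.contDiffAt.comp_contMDiffAt hA'
  have hcr : SmoothAt n (fun y => ((M y).det)⁻¹ * ((M y).cramer (d y)) i) x := by
    refine ((hdetS M hM).inv hdet).mul ?_
    simp only [Matrix.cramer_apply]
    refine hdetS _ fun a b => ?_
    by_cases hb : b = i
    · subst hb; simpa [Matrix.updateCol_self] using hd a
    · simpa [Matrix.updateCol_ne hb] using hM a b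
  refine hcr.congr_of_eventuallyEq ?_
  have hne : ∀ᶠ y in 𝓝 x, (M y).det ≠ 0 := (hdetS M hM).continuousAt.eventually_ne hdet
  filter_upwards [h, hne] with y hy hy0
  rw [Matrix.cramer_eq_adjugate_mulVec, ← hy, Matrix.mulVec_mulVec, Matrix.adjugate_mul,
    Matrix.smul_mulVec, Matrix.one_mulVec, Pi.smul_apply, smul_eq_mul, inv_mul_cancel_left₀ hy0]

theorem isSmoothOn_iff {F : Type} [NormedAddCommGroup F] [NormedSpace ℂ F] {E : X → Type u}
    [TopologicalSpace (TotalSpace F E)] [∀ x, TopologicalSpace (E x)] [FiberBundle F E]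
    {s : ∀ x, E x} {U : Set X} (hU : IsOpen U) :
    IsSmoothOn n F E s U ↔ ∀ x ∈ U,
      SmoothAt n (fun y => (trivializationAt F E x (TotalSpace.mk' F y (s y))).2) x := by
  refine ⟨fun h x hx => ?_, fun h x hx => ?_⟩
  · exact (contMDiffAt_section x).1 ((h x hx).contMDiffAt (hU.mem_nhds hx))
  · exact ((contMDiffAt_section x).2 (h x hx)).contMDiffWithinAt

theorem IsSmoothOn.mono {F : Type} [NormedAddCommGroup F] [NormedSpace ℂ F] {E : X → Type u}
    [TopologicalSpace (TotalSpace F E)] [∀ x, TopologicalSpace (E x)] [FiberBundle F E]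
    {s : ∀ x, E x} {U V : Set X} (h : IsSmoothOn n F E s U) (hV : V ⊆ U) :
    IsSmoothOn n F E s V :=
  ContMDiffOn.mono h hV

/-- Holomorphic sections are `C^∞`. -/
theorem IsHolOn.isSmoothOn {F : Type} [NormedAddCommGroup F] [NormedSpace ℂ F] {E : X → Type u}
    [TopologicalSpace (TotalSpace F E)] [∀ x, TopologicalSpace (E x)] [FiberBundle F E]
    {s : ∀ x, E x} {U : Set X} (hU : IsOpen U) (h : IsHolOn n F E s U) : IsSmoothOn n F E s U := by
  refine (isSmoothOn_iff hU).2 fun x hx => ?_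
  have h1 := (contMDiffAt_section x).1 ((h x hx).contMDiffAt (hU.mem_nhds hx))
  rw [contMDiffAt_iff] at h1
  refine contMDiffAt_iff.2 ⟨h1.1, ?_⟩
  exact (h1.2.restrict_scalars ℝ).of_le le_top

/-- Near every point, a holomorphic line bundle has a nowhere vanishing holomorphic section. -/
theorem exists_isHolOn_ne_zero (L : X → Type u) [TopologicalSpace (TotalSpace ℂ L)]
    [∀ x, NormedAddCommGroup (L x)] [∀ x, InnerProductSpace ℂ (L x)]
    [FiberBundle ℂ L] [VectorBundle ℂ ℂ L]
    [ContMDiffVectorBundle ω ℂ L 𝓘(ℂ, EuclideanSpace ℂ (Fin n))] (x : X) :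
    ∃ U : Set X, IsOpen U ∧ x ∈ U ∧ ∃ ℓ : ∀ y, L y, IsHolOn n ℂ L ℓ U ∧ ∀ y ∈ U, ℓ y ≠ 0 := by
  let T := trivializationAt ℂ L x
  let b := Module.Basis.singleton Unit ℂ
  refine ⟨T.baseSet, T.open_baseSet, mem_baseSet_trivializationAt ℂ L x, T.localFrame b (),
    T.contMDiffOn_localFrame_baseSet ω b (), fun y hy h0 => ?_⟩
  exact ((T.isLocalFrameOn_localFrame_baseSet 𝓘(ℂ, EuclideanSpace ℂ (Fin n)) ω b).linearIndependent
    hy).ne_zero () h0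

end SmoothSections

section SmoothFrame

variable {n r : ℕ} {X : Type u} [TopologicalSpace X] [ChartedSpace (EuclideanSpace ℂ (Fin n)) X]
  {E : X → Type u} [TopologicalSpace (TotalSpace (EuclideanSpace ℂ (Fin r)) E)]
  [∀ x, NormedAddCommGroup (E x)] [∀ x, InnerProductSpace ℂ (E x)]
  [FiberBundle (EuclideanSpace ℂ (Fin r)) E] [VectorBundle ℂ (EuclideanSpace ℂ (Fin r)) E]

/-- The holomorphic frame of `E` near `x` given by the preferred trivialisation at `x`. -/
noncomputable def frame (r : ℕ) {X : Type u} [TopologicalSpace X] (E : X → Type u)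
    [TopologicalSpace (TotalSpace (EuclideanSpace ℂ (Fin r)) E)]
    [∀ x, NormedAddCommGroup (E x)] [∀ x, InnerProductSpace ℂ (E x)]
    [FiberBundle (EuclideanSpace ℂ (Fin r)) E] [VectorBundle ℂ (EuclideanSpace ℂ (Fin r)) E]
    (x : X) (i : Fin r) (y : X) : E y :=
  (trivializationAt (EuclideanSpace ℂ (Fin r)) E x).localFrame
    (EuclideanSpace.basisFun (Fin r) ℂ).toBasis i y

/-- The coordinates of a vector `v ∈ E_y` in the frame of `E` near `x`. -/
noncomputable def coord (r : ℕ) {X : Type u} [TopologicalSpace X] {E : X → Type u}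
    [TopologicalSpace (TotalSpace (EuclideanSpace ℂ (Fin r)) E)] [∀ x, NormedAddCommGroup (E x)]
    [FiberBundle (EuclideanSpace ℂ (Fin r)) E] (x : X) {y : X} (v : E y) (i : Fin r) : ℂ :=
  (trivializationAt (EuclideanSpace ℂ (Fin r)) E x
    (TotalSpace.mk' (EuclideanSpace ℂ (Fin r)) y v)).2 i

/-- The open set over which the frame of `E` near `x` is defined. -/
def frameSet (r : ℕ) {X : Type u} [TopologicalSpace X] (E : X → Type u)
    [TopologicalSpace (TotalSpace (EuclideanSpace ℂ (Fin r)) E)]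
    [∀ x, NormedAddCommGroup (E x)] [FiberBundle (EuclideanSpace ℂ (Fin r)) E] (x : X) : Set X :=
  (trivializationAt (EuclideanSpace ℂ (Fin r)) E x).baseSet

theorem isOpen_frameSet (x : X) : IsOpen (frameSet r E x) := Trivialization.open_baseSet _

theorem mem_frameSet (x : X) : x ∈ frameSet r E x := mem_baseSet_trivializationAt _ _ x

theorem isSmoothOn_frame [ContMDiffVectorBundle ω (EuclideanSpace ℂ (Fin r)) E
    𝓘(ℂ, EuclideanSpace ℂ (Fin n))] (x : X) (i : Fin r) :
    IsSmoothOn n (EuclideanSpace ℂ (Fin r)) E (fun y => frame r E x i y) (frameSet r E x) :=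
  IsHolOn.isSmoothOn (isOpen_frameSet x)
    (Trivialization.contMDiffOn_localFrame_baseSet ω _ _ i)

theorem coord_add {x y : X} (hy : y ∈ frameSet r E x) (u v : E y) (i : Fin r) :
    coord r x (u + v) i = coord r x u i + coord r x v i := by
  have := (Trivialization.linear ℂ (trivializationAt (EuclideanSpace ℂ (Fin r)) E x) hy).map_add u v
  simpa [coord] using congrArg (fun z : EuclideanSpace ℂ (Fin r) => z i) this

theorem coord_smul {x y : X} (hy : y ∈ frameSet r E x) (c : ℂ) (v : E y) (i : Fin r) :
    coord r x (c • v) i = c * coord r x v i := by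
  have :=
    (Trivialization.linear ℂ (trivializationAt (EuclideanSpace ℂ (Fin r)) E x) hy).map_smul c v
  simpa [coord] using congrArg (fun z : EuclideanSpace ℂ (Fin r) => z i) this

theorem coord_sum {ι : Type*} (s : Finset ι) {x y : X} (hy : y ∈ frameSet r E x) (v : ι → E y)
    (i : Fin r) : coord r x (∑ a ∈ s, v a) i = ∑ a ∈ s, coord r x (v a) i := by
  classical
  induction s using Finset.induction_on with
  | empty => simpa using coord_smul hy 0 (0 : E y) i
  | insert a s ha ih => rw [Finset.sum_insert ha, Finset.sum_insert ha, coord_add hy, ih]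

theorem coord_frame {x y : X} (hy : y ∈ frameSet r E x) (a i : Fin r) :
    coord r x (frame r E x a y) i = if i = a then 1 else 0 := by
  let T := trivializationAt (EuclideanSpace ℂ (Fin r)) E x
  have h1 : (T (TotalSpace.mk' (EuclideanSpace ℂ (Fin r)) y (frame r E x a y))).2
      = (EuclideanSpace.basisFun (Fin r) ℂ).toBasis a := by
    rw [frame, Trivialization.localFrame_apply_of_mem_baseSet _ _ hy]
    exact (T.linearEquivAt ℂ y hy).apply_symm_apply _
  change (T (TotalSpace.mk' (EuclideanSpace ℂ (Fin r)) y (frame r E x a y))).2 i = _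
  rw [h1]
  simp

theorem sum_coord_smul_frame {x y : X} (hy : y ∈ frameSet r E x) (v : E y) :
    ∑ i, coord r x v i • frame r E x i y = v := by
  let T := trivializationAt (EuclideanSpace ℂ (Fin r)) E x
  have hinj : Function.Injective fun w : E y =>
      (T (TotalSpace.mk' (EuclideanSpace ℂ (Fin r)) y w)).2 :=
    (T.linearEquivAt ℂ y hy).injective
  refine hinj ?_
  ext i
  change coord r x _ i = coord r x v i
  simp [coord_sum _ hy, coord_smul hy, coord_frame hy]

theorem linearIndependent_frame (x : X) : LinearIndependent ℂ fun i => frame r E x i x := by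
  have hx := mem_frameSet (r := r) (E := E) x
  refine Fintype.linearIndependent_iff.2 fun v hv i => ?_
  have h0 : coord r x (∑ a, v a • frame r E x a x) i = 0 := by
    rw [hv]
    simpa using coord_smul hx 0 (0 : E x) i
  simpa [coord_sum _ hx, coord_smul hx, coord_frame hx] using h0

theorem isSmoothOn_iff_coord {s : ∀ x, E x} {U : Set X} (hU : IsOpen U) :
    IsSmoothOn n (EuclideanSpace ℂ (Fin r)) E s U ↔
      ∀ x ∈ U, ∀ i, SmoothAt n (fun y => coord r x (s y) i) x := by
  rw [isSmoothOn_iff hU]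
  refine forall₂_congr fun x hx => ⟨fun h i => ?_, fun h => ?_⟩
  · exact (((EuclideanSpace.proj (𝕜 := ℂ) i : EuclideanSpace ℂ (Fin r) →L[ℂ] ℂ).restrictScalars
      ℝ).contDiff (n := ∞)).contDiffAt.comp_contMDiffAt h
  · have h' := contMDiffAt_pi_space.2 h
    exact ((((EuclideanSpace.equiv (Fin r) ℂ).symm : (Fin r → ℂ) →L[ℂ]
      EuclideanSpace ℂ (Fin r)).restrictScalars ℝ).contDiff (n := ∞)).contDiffAt.comp_contMDiffAt h'

theorem IsSmoothOn.smul {g : X → ℂ} {s : ∀ x, E x} {U : Set X} (hU : IsOpen U)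
    (hg : ContMDiffOn 𝓘(ℝ, EuclideanSpace ℂ (Fin n)) 𝓘(ℝ, ℂ) ∞ g U)
    (hs : IsSmoothOn n (EuclideanSpace ℂ (Fin r)) E s U) :
    IsSmoothOn n (EuclideanSpace ℂ (Fin r)) E (fun x => g x • s x) U := by
  rw [isSmoothOn_iff_coord hU] at hs ⊢
  intro x hx i
  have h1 : SmoothAt n g x := (hg x hx).contMDiffAt (hU.mem_nhds hx)
  refine (h1.mul (hs x hx i)).congr_of_eventuallyEq ?_
  filter_upwards [(isOpen_frameSet x).mem_nhds (mem_frameSet (r := r) (E := E) x)] with y hy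
  exact coord_smul hy _ _ _

theorem IsSmoothOn.sum {ι : Type*} (a : Finset ι) {s : ι → ∀ x, E x} {U : Set X} (hU : IsOpen U)
    (hs : ∀ i ∈ a, IsSmoothOn n (EuclideanSpace ℂ (Fin r)) E (s i) U) :
    IsSmoothOn n (EuclideanSpace ℂ (Fin r)) E (fun x => ∑ i ∈ a, s i x) U := by
  rw [isSmoothOn_iff_coord hU]
  intro x hx i
  refine (SmoothAt.sum a fun j hj => (isSmoothOn_iff_coord hU).1 (hs j hj) x hx i
    ).congr_of_eventuallyEq ?_
  filter_upwards [(isOpen_frameSet x).mem_nhds (mem_frameSet (r := r) (E := E) x)] with y hy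
  exact coord_sum _ hy _ _

theorem IsSmoothOn.congr {s s' : ∀ x, E x} {U : Set X}
    (hs : IsSmoothOn n (EuclideanSpace ℂ (Fin r)) E s U) (h : ∀ x ∈ U, s' x = s x) :
    IsSmoothOn n (EuclideanSpace ℂ (Fin r)) E s' U :=
  ContMDiffOn.congr hs fun x hx => by rw [h x hx]

theorem IsSmoothOn.of_locally {s : ∀ x, E x} {U : Set X}
    (h : ∀ x ∈ U, ∃ V : Set X, IsOpen V ∧ x ∈ V ∧ IsSmoothOn n (EuclideanSpace ℂ (Fin r)) E s V) :
    IsSmoothOn n (EuclideanSpace ℂ (Fin r)) E s U := fun x hx => by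
  obtain ⟨V, hV, hxV, hs⟩ := h x hx
  exact ((hs x hxV).contMDiffAt (hV.mem_nhds hxV)).contMDiffWithinAt

variable [ContMDiffVectorBundle ω (EuclideanSpace ℂ (Fin r)) E 𝓘(ℂ, EuclideanSpace ℂ (Fin n))]

/-- A section is `C^∞` if its products with all local `C^∞` sections are: its coordinates in a local
frame solve a linear system with the Gram matrix of the frame. -/
theorem isSmoothOn_of_inner (hE : IsSmoothMetric n (EuclideanSpace ℂ (Fin r)) E) {s : ∀ x, E x}
    {U : Set X} (hU : IsOpen U)
    (h : ∀ V : Set X, IsOpen V → V ⊆ U → ∀ u : ∀ x, E x,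
      IsSmoothOn n (EuclideanSpace ℂ (Fin r)) E u V →
      ContMDiffOn 𝓘(ℝ, EuclideanSpace ℂ (Fin n)) 𝓘(ℝ, ℂ) ∞ (fun x => inner ℂ (u x) (s x)) V) :
    IsSmoothOn n (EuclideanSpace ℂ (Fin r)) E s U := by
  rw [isSmoothOn_iff_coord hU]
  intro x hx
  have hV := (isOpen_frameSet (r := r) (E := E) x).inter hU
  have hxV : x ∈ frameSet r E x ∩ U := ⟨mem_frameSet x, hx⟩
  have hb := fun i => (isSmoothOn_frame (n := n) (r := r) (E := E) x i).mono
    (Set.inter_subset_left (t := U))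
  refine SmoothAt.of_mulVec_eq
    (M := fun y => Matrix.of fun i j => inner ℂ (frame r E x i y) (frame r E x j y))
    (d := fun y i => inner ℂ (frame r E x i y) (s y)) (fun i j => ?_) (fun i => ?_) ?_ ?_
  · exact (hE _ hV _ _ (hb i) (hb j) x hxV).contMDiffAt (hV.mem_nhds hxV)
  · exact (h _ hV Set.inter_subset_right _ (hb i) x hxV).contMDiffAt (hV.mem_nhds hxV)
  · intro hdet
    obtain ⟨v, hv0, hv⟩ := Matrix.exists_mulVec_eq_zero_iff.2 hdet
    refine hv0 ?_
    have hzero : ∑ j, v j • frame r E x j x = 0 := by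
      rw [← inner_self_eq_zero (𝕜 := ℂ), sum_inner]
      refine Finset.sum_eq_zero fun i _ => ?_
      have := congrFun hv i
      rw [inner_smul_left, inner_sum]
      simp only [inner_smul_right]
      simp only [Matrix.mulVec, dotProduct, Matrix.of_apply, Pi.zero_apply] at this
      rw [← mul_zero, ← this]
      congr 1
      exact Finset.sum_congr rfl fun j _ => mul_comm _ _
    exact funext fun i =>
      Fintype.linearIndependent_iff.1 (linearIndependent_frame x) v hzero i
  · filter_upwards [hV.mem_nhds hxV] with y hy
    ext i
    simp only [Matrix.mulVec, dotProduct, Matrix.of_apply]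
    conv_rhs => rw [← sum_coord_smul_frame hy.1 (s y), inner_sum]
    simp only [inner_smul_right]
    exact Finset.sum_congr rfl fun j _ => mul_comm _ _

/-! ### Smooth fields of endomorphisms -/

theorem IsSmoothEndOn.comp {A B : ∀ x, E x →ₗ[ℂ] E x} {U : Set X}
    (hA : IsSmoothEndOn n (EuclideanSpace ℂ (Fin r)) E A U)
    (hB : IsSmoothEndOn n (EuclideanSpace ℂ (Fin r)) E B U) :
    IsSmoothEndOn n (EuclideanSpace ℂ (Fin r)) E (fun x => A x ∘ₗ B x) U :=
  fun W hW hWU _ hu => hA W hW hWU _ (hB W hW hWU _ hu)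

theorem IsSmoothEndOn.mono {A : ∀ x, E x →ₗ[ℂ] E x} {U V : Set X}
    (hA : IsSmoothEndOn n (EuclideanSpace ℂ (Fin r)) E A U) (hV : V ⊆ U) :
    IsSmoothEndOn n (EuclideanSpace ℂ (Fin r)) E A V :=
  fun W hW hWV _ hu => hA W hW (hWV.trans hV) _ hu

theorem IsSmoothEndOn.sum {ι : Type*} (a : Finset ι) {A : ι → ∀ x, E x →ₗ[ℂ] E x} {U : Set X}
    (hA : ∀ i ∈ a, IsSmoothEndOn n (EuclideanSpace ℂ (Fin r)) E (A i) U) :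
    IsSmoothEndOn n (EuclideanSpace ℂ (Fin r)) E (fun x => ∑ i ∈ a, A i x) U :=
  fun W hW hWU _ hu => by
    simpa only [LinearMap.sum_apply] using IsSmoothOn.sum a hW fun i hi => hA i hi W hW hWU _ hu

theorem IsSmoothEndOn.const_smul {A : ∀ x, E x →ₗ[ℂ] E x} {U : Set X} (c : ℂ)
    (hA : IsSmoothEndOn n (EuclideanSpace ℂ (Fin r)) E A U) :
    IsSmoothEndOn n (EuclideanSpace ℂ (Fin r)) E (fun x => c • A x) U :=
  fun W hW hWU _ hu => IsSmoothOn.smul hW contMDiffOn_const (hA W hW hWU _ hu)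

theorem IsSmoothEndOn.congr {A B : ∀ x, E x →ₗ[ℂ] E x} {U : Set X}
    (hA : IsSmoothEndOn n (EuclideanSpace ℂ (Fin r)) E A U) (h : ∀ x ∈ U, B x = A x) :
    IsSmoothEndOn n (EuclideanSpace ℂ (Fin r)) E B U :=
  fun W hW hWU _ hu => (hA W hW hWU _ hu).congr fun x hx => by rw [h x (hWU hx)]

theorem IsSmoothEndOn.adjoint [∀ x, FiniteDimensional ℂ (E x)]
    (hE : IsSmoothMetric n (EuclideanSpace ℂ (Fin r)) E) {A : ∀ x, E x →ₗ[ℂ] E x} {U : Set X}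
    (hA : IsSmoothEndOn n (EuclideanSpace ℂ (Fin r)) E A U) :
    IsSmoothEndOn n (EuclideanSpace ℂ (Fin r)) E (fun x => LinearMap.adjoint (A x)) U := by
  intro W hW hWU s hs
  refine isSmoothOn_of_inner hE hW fun V hV hVW u hu => ?_
  simp only [LinearMap.adjoint_inner_right]
  exact hE V hV _ _ (hA V hV (hVW.trans hWU) u hu) (hs.mono hVW)

/-- The inverse of a smooth field of automorphisms is smooth: in a local frame, applying it amounts
to solving a linear system. -/
theorem IsSmoothEndOn.symm {f : ∀ x, E x ≃ₗ[ℂ] E x} {U : Set X}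
    (hf : IsSmoothEndOn n (EuclideanSpace ℂ (Fin r)) E (fun x => (f x).toLinearMap) U) :
    IsSmoothEndOn n (EuclideanSpace ℂ (Fin r)) E (fun x => (f x).symm.toLinearMap) U := by
  intro W hW hWU u hu
  rw [isSmoothOn_iff_coord hW]
  intro x hx
  have hV := (isOpen_frameSet (r := r) (E := E) x).inter hW
  have hxV : x ∈ frameSet r E x ∩ W := ⟨mem_frameSet x, hx⟩
  have hb := fun i => (isSmoothOn_frame (n := n) (r := r) (E := E) x i).mono
    (Set.inter_subset_left (t := W))
  refine SmoothAt.of_mulVec_eq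
    (M := fun y => Matrix.of fun i j => coord r x (f y (frame r E x j y)) i)
    (d := fun y i => coord r x (u y) i) (fun i j => ?_) (fun i => ?_) ?_ ?_
  · exact (isSmoothOn_iff_coord hV).1
      (hf _ hV (Set.inter_subset_right.trans hWU) _ (hb j)) x hxV i
  · exact (isSmoothOn_iff_coord hW).1 hu x hx i
  · intro hdet
    obtain ⟨v, hv0, hv⟩ := Matrix.exists_mulVec_eq_zero_iff.2 hdet
    refine hv0 ?_
    have hzero : ∑ j, v j • frame r E x j x = 0 := by
      refine (f x).injective ?_
      rw [map_zero, ← sum_coord_smul_frame (mem_frameSet (r := r) (E := E) x) (f x _)]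
      refine Finset.sum_eq_zero fun i _ => ?_
      have := congrFun hv i
      simp only [Matrix.mulVec, dotProduct, Matrix.of_apply, Pi.zero_apply] at this
      rw [map_sum, coord_sum _ (mem_frameSet x)]
      simp only [map_smul, coord_smul (mem_frameSet (r := r) (E := E) x)]
      rw [Finset.sum_congr rfl fun j _ => mul_comm (v j) _, this, zero_smul]
    exact funext fun i =>
      Fintype.linearIndependent_iff.1 (linearIndependent_frame x) v hzero i
  · filter_upwards [hV.mem_nhds hxV] with y hy
    ext i
    simp only [Matrix.mulVec, dotProduct, Matrix.of_apply]
    conv_rhs => rw [← (f y).apply_symm_apply (u y), ← sum_coord_smul_frame hy.1 ((f y).symm (u y)),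
      map_sum, coord_sum _ hy.1]
    simp only [map_smul, coord_smul hy.1]
    exact Finset.sum_congr rfl fun j _ => mul_comm _ _

end SmoothFrame

/-! ### Weight spaces of a hermitian matrix -/

section WeightSpaces

variable {N ν : ℕ} {Z : Matrix (Fin N) (Fin N) ℂ} {w : Fin ν → ℚ}

section FromDual

variable {V : Type*} [AddCommGroup V] [Module ℂ V] (S : Module.Basis (Fin N) ℂ V)
  {ζ : Module.End ℂ (Module.Dual ℂ V)}

/-- For a hermitian matrix, conjugation is transposition. -/
theorem weightMatrix_eq_transpose
    (hζ : (LinearMap.toMatrix S.dualBasis S.dualBasis ζ).IsHermitian) :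
    weightMatrix S ζ = (LinearMap.toMatrix S.dualBasis S.dualBasis ζ).transpose := by
  ext i j
  exact hζ.apply j i

theorem isHermitian_weightMatrix
    (hζ : (LinearMap.toMatrix S.dualBasis S.dualBasis ζ).IsHermitian) :
    (weightMatrix S ζ).IsHermitian := by
  rw [weightMatrix_eq_transpose S hζ]
  exact hζ.transpose

theorem hasEigenvalue_weightMatrix_iff
    (hζ : (LinearMap.toMatrix S.dualBasis S.dualBasis ζ).IsHermitian) (μ : ℂ) :
    Module.End.HasEigenvalue (Matrix.toEuclideanLin (weightMatrix S ζ)) μ ↔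
      Module.End.HasEigenvalue ζ μ := by
  have : Module.Finite ℂ (Module.Dual ℂ V) := Module.Finite.of_basis S.dualBasis
  rw [Module.End.hasEigenvalue_iff_isRoot_charpoly, Module.End.hasEigenvalue_iff_isRoot_charpoly,
    Matrix.toEuclideanLin, Matrix.toLpLin_eq_toLin, Matrix.charpoly_toLin,
    weightMatrix_eq_transpose S hζ, Matrix.charpoly_transpose, LinearMap.charpoly_toMatrix]

end FromDual

theorem wtSpace_le_wtLE {i j : Fin ν} (h : j ≤ i) : wtSpace Z w j ≤ wtLE Z w i :=
  le_iSup₂_of_le j h le_rfl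

theorem wtLE_eq_sup (i : Fin ν) : wtLE Z w i = wtSpace Z w i ⊔ wtLT Z w i := by
  refine le_antisymm (iSup₂_le fun j hj => ?_) (sup_le (wtSpace_le_wtLE le_rfl)
    (iSup₂_le fun j hj => wtSpace_le_wtLE hj.le))
  rcases hj.eq_or_lt with rfl | hj
  · exact le_sup_left
  · exact le_sup_of_le_right (le_iSup₂_of_le j hj le_rfl)

theorem wtProj_mem (j : Fin ν) (v : EuclideanSpace ℂ (Fin N)) : wtProj Z w j v ∈ wtSpace Z w j :=
  Submodule.starProjection_apply_mem _ _

theorem wtProj_of_mem {j : Fin ν} {v : EuclideanSpace ℂ (Fin N)} (hv : v ∈ wtSpace Z w j) :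
    wtProj Z w j v = v :=
  Submodule.starProjection_eq_self_iff.2 hv

theorem adjoint_wtProj (j : Fin ν) : LinearMap.adjoint (wtProj Z w j) = wtProj Z w j :=
  ((LinearMap.eq_adjoint_iff _ _).2 fun u v =>
    Submodule.starProjection_isSymmetric (K := wtSpace Z w j) u v).symm

/-- The spectral theorem: `ℂ^N` is the orthogonal sum of the weight spaces. -/
theorem sum_wtProj (hZ : Z.IsHermitian) (hw : Function.Injective w)
    (hZw : ∀ μ : ℂ, Module.End.HasEigenvalue (Matrix.toEuclideanLin Z) μ → ∃ i, μ = (w i : ℂ)) :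
    ∑ j, wtProj Z w j = LinearMap.id := by
  have hT := Matrix.isSymmetric_toEuclideanLin_iff.2 hZ
  have hinj : Function.Injective fun j => (w j : ℂ) := fun i j h =>
    hw (Rat.cast_injective h)
  have hfam : OrthogonalFamily ℂ (fun j => wtSpace Z w j) fun j => (wtSpace Z w j).subtypeₗᵢ :=
    hT.orthogonalFamily_eigenspaces.comp hinj
  have htop : ⨆ j, wtSpace Z w j = ⊤ := by
    rw [eq_top_iff, ← Submodule.orthogonal_eq_bot_iff.1
      hT.orthogonalComplement_iSup_eigenspaces_eq_bot']
    refine iSup_le fun μ => ?_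
    obtain ⟨i, hi⟩ := hZw μ μ.2
    exact le_iSup_of_le i (by rw [wtSpace, ← hi])
  ext1 v
  simpa [wtProj] using hfam.sum_projection_of_mem_iSup v (by rw [htop]; trivial)

open scoped Matrix.Norms.Operator in
theorem sigma_apply_of_mem {j : Fin ν} {v : EuclideanSpace ℂ (Fin N)} (hv : v ∈ wtSpace Z w j)
    (t : ℝ) : sigma Z t v = (Real.exp ((w j : ℝ) * t) : ℂ) • v := by
  have hv' : Matrix.toEuclideanLin Z v = (w j : ℂ) • v := Module.End.mem_eigenspace_iff.1 hv
  have hpow : ∀ m : ℕ, Matrix.toEuclideanLin (((t : ℂ) • Z) ^ m) v = ((w j : ℂ) * t) ^ m • v := by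
    intro m
    induction m with
    | zero => simp [Matrix.toLpLin_eq_toLin]
    | succ m ih =>
      have hmul : Matrix.toEuclideanLin (((t : ℂ) • Z) ^ m * ((t : ℂ) • Z)) v
          = Matrix.toEuclideanLin (((t : ℂ) • Z) ^ m) (Matrix.toEuclideanLin ((t : ℂ) • Z) v) := by
        rw [Matrix.toLpLin_apply, Matrix.toLpLin_apply, Matrix.toLpLin_apply, Matrix.mulVec_mulVec]
      rw [pow_succ, hmul, map_smul, LinearMap.smul_apply, hv', map_smul, map_smul, ih, smul_smul,
        smul_smul]
      congr 1
      ring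
  -- apply the exponential series of `t Z` to `v` termwise
  let ev : Matrix (Fin N) (Fin N) ℂ →ₗ[ℂ] EuclideanSpace ℂ (Fin N) :=
    (LinearMap.applyₗ v) ∘ₗ (Matrix.toEuclideanLin (m := Fin N) (n := Fin N) (𝕜 := ℂ)).toLinearMap
  have hev : Continuous ev := ev.continuous_of_finiteDimensional
  have h1 := (NormedSpace.exp_series_hasSum_exp' (𝕂 := ℂ) ((t : ℂ) • Z)).map ev hev
  have h2 := (NormedSpace.exp_series_hasSum_exp' (𝕂 := ℂ) ((w j : ℂ) * t)).smul_const v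
  have h3 : sigma Z t v = NormedSpace.exp ((w j : ℂ) * t) • v := by
    refine HasSum.unique h1 ?_
    convert h2 using 2 with m
    change ev _ = _
    rw [map_smul, smul_assoc]
    congr 1
    exact hpow m
  rw [h3, ← Complex.exp_eq_exp_ℂ]
  push_cast
  rfl

theorem sigma_eq_sum (hZ : Z.IsHermitian) (hw : Function.Injective w)
    (hZw : ∀ μ : ℂ, Module.End.HasEigenvalue (Matrix.toEuclideanLin Z) μ → ∃ i, μ = (w i : ℂ))
    (t : ℝ) :
    sigma Z t = ∑ j, (Real.exp ((w j : ℝ) * t) : ℂ) • wtProj Z w j := by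
  ext1 v
  conv_lhs => rw [← LinearMap.id_apply (R := ℂ) v, ← sum_wtProj hZ hw hZw]
  simp only [LinearMap.sum_apply, map_sum, LinearMap.smul_apply]
  exact Finset.sum_congr rfl fun j _ => sigma_apply_of_mem (wtProj_mem j v) t

theorem adjoint_sigma_comp_sigma (hZ : Z.IsHermitian) (hw : Function.Injective w)
    (hZw : ∀ μ : ℂ, Module.End.HasEigenvalue (Matrix.toEuclideanLin Z) μ → ∃ i, μ = (w i : ℂ))
    (t : ℝ) :
    LinearMap.adjoint (sigma Z t) ∘ₗ sigma Z t
      = ∑ j, (Real.exp (2 * ((w j : ℝ) * t)) : ℂ) • wtProj Z w j := by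
  have hadj : LinearMap.adjoint (sigma Z t) = sigma Z t := by
    rw [sigma_eq_sum hZ hw hZw t, map_sum]
    refine Finset.sum_congr rfl fun j _ => ?_
    rw [map_smulₛₗ, adjoint_wtProj, Complex.conj_ofReal]
  rw [hadj]
  ext1 v
  have hv : sigma Z t v = ∑ j, (Real.exp ((w j : ℝ) * t) : ℂ) • wtProj Z w j v := by
    simp only [sigma_eq_sum hZ hw hZw t, LinearMap.sum_apply, LinearMap.smul_apply]
  rw [LinearMap.comp_apply, hv, map_sum, LinearMap.sum_apply]
  refine Finset.sum_congr rfl fun j _ => ?_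
  rw [map_smul, sigma_apply_of_mem (wtProj_mem j v) t, smul_smul, ← Complex.ofReal_mul,
    ← Real.exp_add, ← two_mul, LinearMap.smul_apply]

end WeightSpaces

/-! ### The block decomposition over the regular locus -/

section Blocks

theorem linearMap_sum_comp {ι V₁ V₂ V₃ : Type*} [AddCommGroup V₁] [Module ℂ V₁] [AddCommGroup V₂]
    [Module ℂ V₂] [AddCommGroup V₃] [Module ℂ V₃] (s : Finset ι) (A : ι → V₂ →ₗ[ℂ] V₃)
    (B : V₁ →ₗ[ℂ] V₂) : (∑ i ∈ s, A i) ∘ₗ B = ∑ i ∈ s, A i ∘ₗ B := by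
  ext1 v
  simp

theorem linearMap_comp_sum {ι V₁ V₂ V₃ : Type*} [AddCommGroup V₁] [Module ℂ V₁] [AddCommGroup V₂]
    [Module ℂ V₂] [AddCommGroup V₃] [Module ℂ V₃] (s : Finset ι) (A : V₂ →ₗ[ℂ] V₃)
    (B : ι → V₁ →ₗ[ℂ] V₂) : A ∘ₗ (∑ i ∈ s, B i) = ∑ i ∈ s, A ∘ₗ B i := by
  ext1 v
  simp

variable {n r : ℕ} {X : Type u} [TopologicalSpace X] [ChartedSpace (EuclideanSpace ℂ (Fin n)) X]
  {E : X → Type u} [TopologicalSpace (TotalSpace (EuclideanSpace ℂ (Fin r)) E)]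
  [∀ x, NormedAddCommGroup (E x)] [∀ x, InnerProductSpace ℂ (E x)]
  [∀ x, FiniteDimensional ℂ (E x)]
  [FiberBundle (EuclideanSpace ℂ (Fin r)) E]
  [VectorBundle ℂ (EuclideanSpace ℂ (Fin r)) E]
  {L : X → Type u} [TopologicalSpace (TotalSpace ℂ L)]
  [∀ x, NormedAddCommGroup (L x)] [∀ x, InnerProductSpace ℂ (L x)] [FiberBundle ℂ L]
  {k : ℤ} {N ν : ℕ} {S : Module.Basis (Fin N) ℂ (H0 n r E L k)}
  {Z : Matrix (Fin N) (Fin N) ℂ} {w : Fin ν → ℚ} {e : ∀ x, L x} {f : ∀ x, E x ≃ₗ[ℂ] E x}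
  {Ψ : Splitting S Z w e} {x : X}

theorem splitProj_apply (hx : x ∈ regLocus S Z w) (α : hatSet S Z w e) (v : E x) :
    splitProj S Z w e Ψ.iso α x v = (Ψ.iso x hx).symm (Pi.single α (Ψ.iso x hx v α)) := by
  rw [splitProj, dif_pos hx]
  rfl

theorem pr_apply (hx : x ∈ regLocus S Z w) (α : hatSet S Z w e) (v : E x) :
    pr S Z w e f Ψ α x v
      = f x ((Ψ.iso x hx).symm (Pi.single α (Ψ.iso x hx ((f x).symm v) α))) := by
  rw [← splitProj_apply hx]
  rfl

theorem sum_pr (hx : x ∈ regLocus S Z w) : ∑ α, pr S Z w e f Ψ α x = LinearMap.id := by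
  ext1 v
  simp only [LinearMap.sum_apply, pr_apply hx, ← map_sum, Finset.univ_sum_single]
  simp

theorem pr_comp_pr_self (hx : x ∈ regLocus S Z w) (α : hatSet S Z w e) :
    pr S Z w e f Ψ α x ∘ₗ pr S Z w e f Ψ α x = pr S Z w e f Ψ α x := by
  ext1 v
  simp [pr_apply hx]

theorem pr_comp_pr_of_ne (hx : x ∈ regLocus S Z w) {α β : hatSet S Z w e} (h : α ≠ β) :
    pr S Z w e f Ψ α x ∘ₗ pr S Z w e f Ψ β x = 0 := by
  ext1 v
  simp [pr_apply hx, Pi.single_eq_of_ne h]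

theorem weightGauge_comp_neg (hx : x ∈ regLocus S Z w) (t : ℝ) :
    weightGauge S Z w e f Ψ t x ∘ₗ weightGauge S Z w e f Ψ (-t) x = LinearMap.id := by
  rw [← sum_pr (f := f) (Ψ := Ψ) hx]
  simp only [weightGauge, linearMap_sum_comp, linearMap_comp_sum]
  refine Finset.sum_congr rfl fun α _ => ?_
  rw [Finset.sum_eq_single α]
  · rw [LinearMap.smul_comp, LinearMap.comp_smul, pr_comp_pr_self hx, smul_smul,
      ← Complex.ofReal_mul, ← Real.exp_add]
    simp
  · intro β _ hβ
    rw [LinearMap.smul_comp, LinearMap.comp_smul, pr_comp_pr_of_ne hx hβ, smul_zero, smul_zero]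
  · simp

/-- `h_{σ_t}` is recovered from the renormalised metric by the inverse gauge transformation. -/
theorem hFS_eq_weightGauge_comp_hRen (hx : x ∈ regLocus S Z w) (t : ℝ) :
    hFS S Z e f t x = weightGauge S Z w e f Ψ t x ∘ₗ hRen S Z w e f Ψ t x ∘ₗ
      LinearMap.adjoint (weightGauge S Z w e f Ψ t x) := by
  have h := weightGauge_comp_neg (f := f) (Ψ := Ψ) hx t
  have h' := congrArg LinearMap.adjoint h
  rw [LinearMap.adjoint_comp, LinearMap.adjoint_id] at h'
  ext1 v
  have h1 := fun u => LinearMap.congr_fun h u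
  have h2 := LinearMap.congr_fun h' v
  simp only [LinearMap.comp_apply, LinearMap.id_apply] at h1 h2
  simp only [hRen, LinearMap.comp_apply, h1, h2]

/-- `Q^*_{j → α}` vanishes for `j < α`, as `ρ` maps `V_{w_j}` to `E_{≤ -w_{α-1}}`. -/
theorem Qs_eq_zero_of_lt (hx : x ∈ regLocus S Z w) {j : Fin ν} {α : hatSet S Z w e}
    (h : j < α.1) : Qs S Z w e f Ψ j α x = 0 := by
  ext1 c
  have hmem : rho S x (e x) (wtProj Z w j c) ∈ fibLT S Z w e α x :=
    Submodule.mem_map_of_mem (Submodule.mem_iSup_of_mem j (Submodule.mem_iSup_of_mem h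
      (wtProj_mem j c)))
  have hle : fibLT S Z w e α x ≤ fibLE S Z w e α x :=
    Submodule.map_mono (by rw [wtLE_eq_sup]; exact le_sup_right)
  have h0 := Ψ.iso_eq_mk x hx α ⟨_, hle hmem⟩
  rw [(Submodule.Quotient.mk_eq_zero _).2 (by exact hmem)] at h0
  simp [Qs, Qstar, pr_apply hx, h0]

/-- The summand `E_{-w_α}` is the range of `Q^*_{α → α}`: modulo `E_{≤ -w_{α-1}}`, the image
`E_{≤ -w_α}` is spanned by `ρ(V_{w_α})`. -/
theorem range_pr_le_range_Qs (hx : x ∈ regLocus S Z w) (α : hatSet S Z w e) :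
    LinearMap.range (pr S Z w e f Ψ α x) ≤ LinearMap.range (Qs S Z w e f Ψ α α x) := by
  rintro _ ⟨v, rfl⟩
  obtain ⟨⟨y, hy⟩, hyv⟩ := Submodule.Quotient.mk_surjective _ (Ψ.iso x hx ((f x).symm v) α)
  obtain ⟨c, hc, hcy⟩ := id hy
  rw [SetLike.mem_coe, wtLE_eq_sup] at hc
  obtain ⟨c₁, hc₁, c₂, hc₂, rfl⟩ := Submodule.mem_sup.1 hc
  have hmem : rho S x (e x) c₁ ∈ fibLE S Z w e α x :=
    Submodule.mem_map_of_mem (wtSpace_le_wtLE le_rfl hc₁)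
  refine ⟨c₁, ?_⟩
  have h1 := Ψ.iso_eq_mk x hx α ⟨_, hmem⟩
  have h2 : (Submodule.Quotient.mk ⟨rho S x (e x) c₁, hmem⟩ : fibGr S Z w e α x)
      = Submodule.Quotient.mk ⟨y, hy⟩ := by
    refine ((Submodule.Quotient.eq _).2 ?_).symm
    change y - rho S x (e x) c₁ ∈ fibLT S Z w e α x
    rw [← hcy, map_add, add_sub_cancel_left]
    exact Submodule.mem_map_of_mem hc₂
  rw [pr_apply hx, ← hyv, ← h2, ← h1]
  simp [Qs, Qstar, pr_apply hx, wtProj_of_mem hc₁]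

theorem Qs_comp_Qa (j : Fin ν) (α β : hatSet S Z w e) :
    Qs S Z w e f Ψ j α x ∘ₗ Qa S Z w e f Ψ β j x
      = pr S Z w e f Ψ α x ∘ₗ
        (Qstar S e f x ∘ₗ wtProj Z w j ∘ₗ LinearMap.adjoint (Qstar S e f x)) ∘ₗ
        LinearMap.adjoint (pr S Z w e f Ψ β x) := by
  ext1 v
  simp only [Qa, Qs, LinearMap.adjoint_comp, adjoint_wtProj, LinearMap.comp_apply]
  rw [wtProj_of_mem (wtProj_mem _ _)]

/-- The expansion of the renormalised metric in the weights. -/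
theorem hRen_eq_sum (hZ : Z.IsHermitian) (hw : Function.Injective w)
    (hZw : ∀ μ : ℂ, Module.End.HasEigenvalue (Matrix.toEuclideanLin Z) μ → ∃ i, μ = (w i : ℂ))
    (t : ℝ) :
    hRen S Z w e f Ψ t x = ∑ α : hatSet S Z w e, ∑ β : hatSet S Z w e, ∑ j,
      ((Real.exp (-((w α : ℝ) - w j) * t) * Real.exp (-((w β : ℝ) - w j) * t) : ℝ) : ℂ) •
        (Qs S Z w e f Ψ j α x ∘ₗ Qa S Z w e f Ψ β j x) := by
  have h1 : hFS S Z e f t x = ∑ j, (Real.exp (2 * ((w j : ℝ) * t)) : ℂ) •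
      (Qstar S e f x ∘ₗ wtProj Z w j ∘ₗ LinearMap.adjoint (Qstar S e f x)) := by
    rw [hFS, ← LinearMap.comp_assoc _ (sigma Z t), adjoint_sigma_comp_sigma hZ hw hZw]
    simp only [linearMap_sum_comp, linearMap_comp_sum, LinearMap.smul_comp, LinearMap.comp_smul]
  rw [hRen, h1]
  simp only [weightGauge, map_sum, map_smulₛₗ, Complex.conj_ofReal]
  simp only [linearMap_sum_comp, linearMap_comp_sum, LinearMap.smul_comp, LinearMap.comp_smul,
    Qs_comp_Qa]
  rw [Finset.sum_comm (s := Finset.univ (α := hatSet S Z w e))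
    (t := Finset.univ (α := hatSet S Z w e))]
  refine Finset.sum_congr rfl fun β _ => ?_
  rw [Finset.sum_comm, Finset.smul_sum]
  refine Finset.sum_congr rfl fun j _ => ?_
  rw [Finset.smul_sum, Finset.smul_sum]
  refine Finset.sum_congr rfl fun α _ => ?_
  rw [smul_smul, smul_smul]
  congr 1
  simp only [← Complex.ofReal_mul, ← Real.exp_add]
  congr 2
  ring

/-- The terms of the expansion with `j = α = β` form `ĥ`, those with `j < α` or `j < β` vanish, and
the others form the error term. -/
theorem hRen_eq_hLim_add_errTerm (hx : x ∈ regLocus S Z w) (hZ : Z.IsHermitian)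
    (hw : Function.Injective w)
    (hZw : ∀ μ : ℂ, Module.End.HasEigenvalue (Matrix.toEuclideanLin Z) μ → ∃ i, μ = (w i : ℂ))
    (t : ℝ) :
    hRen S Z w e f Ψ t x = hLim S Z w e f Ψ x + errTerm S Z w e f Ψ t x := by
  classical
  have hdiag : hLim S Z w e f Ψ x = ∑ α : hatSet S Z w e, ∑ β : hatSet S Z w e,
      ∑ j ∈ Finset.univ.filter (fun j : Fin ν => j = α.1 ∧ j = β.1),
        ((Real.exp (-((w α : ℝ) - w j) * t) * Real.exp (-((w β : ℝ) - w j) * t) : ℝ) : ℂ) •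
          (Qs S Z w e f Ψ j α x ∘ₗ Qa S Z w e f Ψ β j x) := by
    refine Finset.sum_congr rfl fun α _ => ?_
    rw [Finset.sum_eq_single α]
    · rw [Finset.sum_eq_single α.1]
      · simp
      · intro j hj hne
        exact absurd (Finset.mem_filter.1 hj).2.1 hne
      · simp
    · intro β _ hβ
      refine Finset.sum_eq_zero fun j hj => absurd (Subtype.ext ?_) hβ
      exact (Finset.mem_filter.1 hj).2.2.symm.trans (Finset.mem_filter.1 hj).2.1
    · simp
  rw [hRen_eq_sum hZ hw hZw, hdiag, errTerm]
  simp only [← Finset.sum_add_distrib]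
  refine Finset.sum_congr rfl fun α _ => Finset.sum_congr rfl fun β _ => ?_
  rw [← Finset.sum_union]
  · refine (Finset.sum_subset (Finset.subset_univ _) fun j _ hj => ?_).symm
    -- outside both index sets, `j < α` or `j < β`
    have hlt : j < α.1 ∨ j < β.1 := by
      simp only [Finset.mem_union, Finset.mem_filter, Finset.mem_univ, true_and] at hj
      grind
    rcases hlt with h | h
    · rw [Qs_eq_zero_of_lt hx h, LinearMap.zero_comp, smul_zero]
    · rw [Qa, Qs_eq_zero_of_lt hx h, map_zero, LinearMap.comp_zero, smul_zero]
  · refine Finset.disjoint_filter.2 fun j _ h1 h2 => ?_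
    grind

theorem isSymmetric_comp_comp_adjoint {V V' : Type*} [NormedAddCommGroup V]
    [InnerProductSpace ℂ V] [FiniteDimensional ℂ V] [NormedAddCommGroup V']
    [InnerProductSpace ℂ V'] [FiniteDimensional ℂ V'] (A : V →ₗ[ℂ] V') {B : V →ₗ[ℂ] V}
    (hB : B.IsSymmetric) : (A ∘ₗ B ∘ₗ LinearMap.adjoint A).IsSymmetric := fun u v => by
  simp only [LinearMap.comp_apply]
  rw [← LinearMap.adjoint_inner_right, hB, LinearMap.adjoint_inner_left]

theorem isSymmetric_hRen (t : ℝ) : (hRen S Z w e f Ψ t x).IsSymmetric := by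
  refine isSymmetric_comp_comp_adjoint _ ?_
  refine isSymmetric_comp_comp_adjoint (Qstar S e f x)
    (B := LinearMap.adjoint (sigma Z t) ∘ₗ sigma Z t) fun u v => ?_
  simp only [LinearMap.comp_apply, LinearMap.adjoint_inner_left, LinearMap.adjoint_inner_right]

theorem isSymmetric_hLim : (hLim S Z w e f Ψ x).IsSymmetric := by
  intro u v
  simp only [hLim, Qa, LinearMap.sum_apply, sum_inner, inner_sum, LinearMap.comp_apply]
  refine Finset.sum_congr rfl fun α _ => ?_
  rw [← LinearMap.adjoint_inner_right, LinearMap.adjoint_inner_left]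

/-- `ĥ` is positive definite, as the ranges of the `Q^*_{α → α}` span `E_x`. -/
theorem hLim_posDef (hx : x ∈ regLocus S Z w) {u : E x} (hu : u ≠ 0) :
    0 < (inner ℂ (hLim S Z w e f Ψ x u) u).re := by
  have hsum : (inner ℂ (hLim S Z w e f Ψ x u) u).re
      = ∑ α : hatSet S Z w e, ‖Qa S Z w e f Ψ α α x u‖ ^ 2 := by
    simp only [hLim, LinearMap.sum_apply, sum_inner, LinearMap.comp_apply, Complex.re_sum]
    refine Finset.sum_congr rfl fun α _ => ?_
    rw [← LinearMap.adjoint_inner_right]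
    exact inner_self_eq_norm_sq (𝕜 := ℂ) _
  rw [hsum]
  refine lt_of_le_of_ne (Finset.sum_nonneg fun α _ => sq_nonneg _) fun h0 => hu ?_
  have hz := (Finset.sum_eq_zero_iff_of_nonneg fun α _ => sq_nonneg _).1 h0.symm
  have horth : ∀ v : E x, inner ℂ u v = 0 := fun v => by
    rw [← LinearMap.id_apply (R := ℂ) v, ← sum_pr (f := f) (Ψ := Ψ) hx, LinearMap.sum_apply,
      inner_sum]
    refine Finset.sum_eq_zero fun α hα => ?_
    obtain ⟨c, hc⟩ := range_pr_le_range_Qs hx α (LinearMap.mem_range_self (pr S Z w e f Ψ α x) v)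
    rw [← hc, ← LinearMap.adjoint_inner_left]
    have : Qa S Z w e f Ψ α α x u = 0 := by simpa using hz α hα
    rw [Qa] at this
    rw [this, inner_zero_left]
  exact inner_self_eq_zero.1 (horth u)

end Blocks

/-! ### Exponential decay -/

section Decay

variable {n : ℕ} {X : Type u} [TopologicalSpace X] [ChartedSpace (EuclideanSpace ℂ (Fin n)) X]

theorem SmoothAt.contDiffAt_comp_chartAt_symm {g : X → ℂ} {x : X} (hg : SmoothAt n g x) :
    ContDiffAt ℝ ∞ (g ∘ (chartAt (EuclideanSpace ℂ (Fin n)) x).symm)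
      (chartAt (EuclideanSpace ℂ (Fin n)) x x) := by
  have h := (contMDiffAt_iff.1 hg).2
  rw [ModelWithCorners.range_eq_univ] at h
  exact contDiffWithinAt_univ.1 h

/-- A combination of finitely many fixed smooth functions, with coefficients decaying like
`exp (-c t)`, decays like `exp (-c t)` together with all derivatives. -/
theorem decaysOn_sum_mul {ι : Type*} (s : Finset ι) {c : ℝ} {a : ι → ℝ → ℂ} {g : ι → X → ℂ}
    {U : Set X} (hg : ∀ i ∈ s, ∀ x ∈ U, SmoothAt n (g i) x)
    (ha : ∀ i ∈ s, ∀ t : ℝ, 0 ≤ t → ‖a i t‖ ≤ Real.exp (-c * t)) :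
    DecaysOn n c (fun t x => ∑ i ∈ s, a i t * g i x) U := by
  intro x₀ hx₀ m
  set φ := chartAt (EuclideanSpace ℂ (Fin n)) x₀
  have hφ : ContinuousAt φ x₀ := φ.continuousAt (mem_chart_source _ x₀)
  -- `g i` is `C^m` in the chart at `x₀`, hence near `x₀`, with continuous `m`-th derivative
  have hsm : ∀ i ∈ s, ContDiffAt ℝ (m : ℕ∞ω) (g i ∘ φ.symm) (φ x₀) := fun i hi =>
    ((hg i hi x₀ hx₀).contDiffAt_comp_chartAt_symm).of_le (by exact_mod_cast le_top)
  refine ⟨∑ i ∈ s, (‖iteratedFDeriv ℝ m (g i ∘ φ.symm) (φ x₀)‖ + 1), ?_⟩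
  have hbd : ∀ i ∈ s, ∀ᶠ x in 𝓝 x₀, ‖iteratedFDeriv ℝ m (g i ∘ φ.symm) (φ x)‖
      ≤ ‖iteratedFDeriv ℝ m (g i ∘ φ.symm) (φ x₀)‖ + 1 := fun i hi => by
    have hcont : ContinuousAt (iteratedFDeriv ℝ m (g i ∘ φ.symm)) (φ x₀) :=
      ((hsm i hi).iteratedFDeriv_right (m := 0) (i := m) (by simp)).continuousAt
    have h1 : ContinuousAt (fun x => ‖iteratedFDeriv ℝ m (g i ∘ φ.symm) (φ x)‖) x₀ :=
      (ContinuousAt.comp (f := φ) hcont hφ).norm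
    exact (h1.eventually_lt_const (lt_add_one _)).mono fun _ h => h.le
  have hev : ∀ i ∈ s, ∀ᶠ x in 𝓝 x₀, ContDiffAt ℝ (m : ℕ∞ω) (g i ∘ φ.symm) (φ x) := fun i hi =>
    hφ.eventually ((hsm i hi).eventually (by simp))
  filter_upwards [(Finset.eventually_all s).2 hbd, (Finset.eventually_all s).2 hev]
    with x h1 h2 t ht
  have hfun : (fun x => ∑ i ∈ s, a i t * g i x) ∘ φ.symm
      = ∑ i ∈ s, fun y => a i t • (g i ∘ φ.symm) y := by
    ext y
    simp [Finset.sum_apply]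
  rw [hfun, iteratedFDeriv_sum_apply fun i hi => (h2 i hi).const_smul (a i t), Finset.sum_mul]
  refine (norm_sum_le _ _).trans (Finset.sum_le_sum fun i hi => ?_)
  have hconst : iteratedFDeriv ℝ m (fun y => a i t • (g i ∘ φ.symm) y) (φ x)
      = a i t • iteratedFDeriv ℝ m (g i ∘ φ.symm) (φ x) :=
    iteratedFDeriv_const_smul_apply' (h2 i hi)
  rw [hconst, norm_smul, mul_comm]
  exact mul_le_mul (h1 i hi) (ha i hi t ht) (norm_nonneg _) (by positivity)

end Decay

/-! ### Smoothness of the blocks -/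

section SmoothBlocks

variable {n r : ℕ} {X : Type u} [TopologicalSpace X] [ChartedSpace (EuclideanSpace ℂ (Fin n)) X]
  {E : X → Type u} [TopologicalSpace (TotalSpace (EuclideanSpace ℂ (Fin r)) E)]
  [∀ x, NormedAddCommGroup (E x)] [∀ x, InnerProductSpace ℂ (E x)]
  [∀ x, FiniteDimensional ℂ (E x)]
  [FiberBundle (EuclideanSpace ℂ (Fin r)) E]
  [VectorBundle ℂ (EuclideanSpace ℂ (Fin r)) E]
  [ContMDiffVectorBundle ω (EuclideanSpace ℂ (Fin r)) E 𝓘(ℂ, EuclideanSpace ℂ (Fin n))]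
  {L : X → Type u} [TopologicalSpace (TotalSpace ℂ L)]
  [∀ x, NormedAddCommGroup (L x)] [∀ x, InnerProductSpace ℂ (L x)] [FiberBundle ℂ L]
  [VectorBundle ℂ ℂ L] [ContMDiffVectorBundle ω ℂ L 𝓘(ℂ, EuclideanSpace ℂ (Fin n))]
  {k : ℤ} {N ν : ℕ} {S : Module.Basis (Fin N) ℂ (H0 n r E L k)}
  {Z : Matrix (Fin N) (Fin N) ℂ} {w : Fin ν → ℚ} {e : ∀ x, L x} {f : ∀ x, E x ≃ₗ[ℂ] E x}
  {Ψ : Splitting S Z w e}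

/-- The fibres of a line bundle are one-dimensional. -/
theorem exists_eq_smul_of_ne_zero (x : X) {ℓ : L x} (hℓ : ℓ ≠ 0) (ℓ' : L x) :
    ∃ c : ℂ, ℓ' = c • ℓ := by
  have hx := mem_baseSet_trivializationAt ℂ L x
  let φ := (trivializationAt ℂ L x).linearEquivAt ℂ x hx
  have hφ : φ ℓ ≠ 0 := fun h => hℓ (φ.map_eq_zero_iff.1 h)
  exact ⟨φ ℓ' / φ ℓ, φ.injective (by rw [map_smul, smul_eq_mul, div_mul_cancel₀ _ hφ])⟩

theorem rho_smul (x : X) {c : ℂ} (hc : c ≠ 0) (ℓ : L x) :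
    rho S x (c • ℓ) = c ^ (-k) • rho S x ℓ := by
  ext1 v
  simp only [rho, LinearMap.sum_apply, LinearMap.smul_apply, LinearMap.smulRight_apply,
    Finset.smul_sum]
  refine Finset.sum_congr rfl fun i _ => ?_
  rw [((S i).2.1 x trivial).2 c ℓ hc, smul_comm]

/-- The endomorphism `Q^* A Q` does not depend on the phase of the unit vector `e x`, and can be
computed by means of any nonzero vector of `L_x`. -/
theorem Qstar_comp_comp_adjoint_eq (A : EuclideanSpace ℂ (Fin N) →ₗ[ℂ] EuclideanSpace ℂ (Fin N))
    {x : X} (he : ‖e x‖ = 1) {ℓ : L x} (hℓ : ℓ ≠ 0) :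
    Qstar S e f x ∘ₗ A ∘ₗ LinearMap.adjoint (Qstar S e f x)
      = (inner ℂ ℓ ℓ : ℂ) ^ k • (((f x).toLinearMap ∘ₗ rho S x ℓ) ∘ₗ A ∘ₗ
        LinearMap.adjoint ((f x).toLinearMap ∘ₗ rho S x ℓ)) := by
  obtain ⟨c, hc⟩ := exists_eq_smul_of_ne_zero x hℓ (e x)
  have hc0 : c ≠ 0 := by
    rintro rfl
    rw [hc, zero_smul, norm_zero] at he
    exact zero_ne_one he
  have hcc : c * (starRingEnd ℂ) c * inner ℂ ℓ ℓ = 1 := by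
    have h1 : (inner ℂ (e x) (e x) : ℂ) = 1 := by
      rw [inner_self_eq_norm_sq_to_K, he]; simp
    rw [← h1, hc, inner_smul_left, inner_smul_right]
    ring
  have hQ : Qstar S e f x = c ^ (-k) • ((f x).toLinearMap ∘ₗ rho S x ℓ) := by
    rw [Qstar, hc, rho_smul x hc0, LinearMap.comp_smul]
  have hk : c ^ (-k) * (starRingEnd ℂ) (c ^ (-k)) = (inner ℂ ℓ ℓ : ℂ) ^ k := by
    rw [map_zpow₀, ← mul_zpow, zpow_neg, ← inv_zpow, ← eq_inv_of_mul_eq_one_right hcc]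
  rw [hQ, map_smulₛₗ, LinearMap.smul_comp, LinearMap.comp_smul, LinearMap.comp_smul, smul_smul, hk]

/-- The endomorphisms `Q^* A Q` are smooth, although the unit vectors `e x` need not vary
continuously. -/
theorem isSmoothEndOn_Qstar_comp_comp_adjoint (hL : IsSmoothMetric n ℂ L)
    (hE : IsSmoothMetric n (EuclideanSpace ℂ (Fin r)) E) (he : ∀ x, ‖e x‖ = 1)
    (hf : IsSmoothEndOn n (EuclideanSpace ℂ (Fin r)) E (fun x => (f x).toLinearMap) Set.univ)
    (A : EuclideanSpace ℂ (Fin N) →ₗ[ℂ] EuclideanSpace ℂ (Fin N)) :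
    IsSmoothEndOn n (EuclideanSpace ℂ (Fin r)) E
      (fun x => Qstar S e f x ∘ₗ A ∘ₗ LinearMap.adjoint (Qstar S e f x)) Set.univ := by
  intro W hW _ u hu
  refine IsSmoothOn.of_locally fun x hx => ?_
  obtain ⟨U, hU, hxU, ℓ, hℓ, hℓ0⟩ := exists_isHolOn_ne_zero (n := n) L x
  have hV := hU.inter hW
  refine ⟨U ∩ W, hV, ⟨hxU, hx⟩, ?_⟩
  have hℓs : IsSmoothOn n ℂ L ℓ (U ∩ W) := (hℓ.isSmoothOn hU).mono Set.inter_subset_left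
  let R : ∀ y, EuclideanSpace ℂ (Fin N) →ₗ[ℂ] E y := fun y => (f y).toLinearMap ∘ₗ rho S y (ℓ y)
  have hR : ∀ v, IsSmoothOn n (EuclideanSpace ℂ (Fin r)) E (fun y => R y v) (U ∩ W) := fun v => by
    refine hf _ hV (Set.subset_univ _) _ ?_
    simp only [rho, LinearMap.sum_apply, LinearMap.smulRight_apply]
    refine IsSmoothOn.sum _ hV fun i _ => IsSmoothOn.smul hV contMDiffOn_const ?_
    exact ((S i).2.2 _ hV (Set.subset_univ _) ℓ (ContMDiffOn.mono hℓ Set.inter_subset_left)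
      fun y hy => hℓ0 y hy.1).isSmoothOn hV
  -- expanding `A R^* u` in the standard basis exhibits `R A R^* u` as a combination of the sections
  -- `R ε_a`, with coefficients given by the metric on `E`
  have hexp : ∀ y, R y (A (LinearMap.adjoint (R y) (u y))) = ∑ a : Fin N,
      (inner ℂ (R y (LinearMap.adjoint A (EuclideanSpace.single a 1))) (u y) : ℂ) •
        R y (EuclideanSpace.single a 1) := fun y => by
    conv_lhs => rw [← (EuclideanSpace.basisFun (Fin N) ℂ).sum_repr' (A _), map_sum]
    refine Finset.sum_congr rfl fun a _ => ?_
    rw [map_smul, EuclideanSpace.basisFun_apply, ← LinearMap.adjoint_inner_left,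
      LinearMap.adjoint_inner_right]
  have hsm : IsSmoothOn n (EuclideanSpace ℂ (Fin r)) E
      (fun y => (inner ℂ (ℓ y) (ℓ y) : ℂ) ^ k • R y (A (LinearMap.adjoint (R y) (u y))))
      (U ∩ W) := by
    refine IsSmoothOn.smul hV (fun y hy => ?_) ?_
    · have h1 : SmoothAt n (fun y => (inner ℂ (ℓ y) (ℓ y) : ℂ)) y :=
        (hL _ hV _ _ hℓs hℓs y hy).contMDiffAt (hV.mem_nhds hy)
      exact (h1.zpow (fun h => hℓ0 y hy.1 (inner_self_eq_zero.1 h)) k).contMDiffWithinAt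
    · simp only [hexp]
      exact IsSmoothOn.sum _ hV fun a _ => IsSmoothOn.smul hV
        (hE _ hV _ _ (hR _) (hu.mono Set.inter_subset_right)) (hR _)
  refine hsm.congr fun y hy => ?_
  change (Qstar S e f y ∘ₗ A ∘ₗ LinearMap.adjoint (Qstar S e f y)) (u y) = _
  rw [Qstar_comp_comp_adjoint_eq A (he y) (hℓ0 y hy.1)]
  rfl

theorem isSmoothEndOn_pr
    (hf : IsSmoothEndOn n (EuclideanSpace ℂ (Fin r)) E (fun x => (f x).toLinearMap) Set.univ)
    (α : hatSet S Z w e) :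
    IsSmoothEndOn n (EuclideanSpace ℂ (Fin r)) E (pr S Z w e f Ψ α) (regLocus S Z w) :=
  (hf.mono (Set.subset_univ _)).comp ((Ψ.smooth α).comp (hf.symm.mono (Set.subset_univ _)))

theorem isSmoothEndOn_Qs_comp_Qa (hL : IsSmoothMetric n ℂ L)
    (hE : IsSmoothMetric n (EuclideanSpace ℂ (Fin r)) E) (he : ∀ x, ‖e x‖ = 1)
    (hf : IsSmoothEndOn n (EuclideanSpace ℂ (Fin r)) E (fun x => (f x).toLinearMap) Set.univ)
    (j : Fin ν) (α β : hatSet S Z w e) :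
    IsSmoothEndOn n (EuclideanSpace ℂ (Fin r)) E
      (fun x => Qs S Z w e f Ψ j α x ∘ₗ Qa S Z w e f Ψ β j x) (regLocus S Z w) :=
  ((isSmoothEndOn_pr hf α).comp (((isSmoothEndOn_Qstar_comp_comp_adjoint hL hE he hf _).mono
    (Set.subset_univ _)).comp ((isSmoothEndOn_pr hf β).adjoint hE))).congr fun _ _ =>
      Qs_comp_Qa j α β

theorem isSmoothEndOn_hLim (hL : IsSmoothMetric n ℂ L)
    (hE : IsSmoothMetric n (EuclideanSpace ℂ (Fin r)) E) (he : ∀ x, ‖e x‖ = 1)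
    (hf : IsSmoothEndOn n (EuclideanSpace ℂ (Fin r)) E (fun x => (f x).toLinearMap) Set.univ) :
    IsSmoothEndOn n (EuclideanSpace ℂ (Fin r)) E (hLim S Z w e f Ψ) (regLocus S Z w) := by
  refine IsSmoothEndOn.congr (A := fun x => ∑ α : hatSet S Z w e,
    Qs S Z w e f Ψ α α x ∘ₗ Qa S Z w e f Ψ α α x) ?_ fun x _ => rfl
  exact IsSmoothEndOn.sum _ fun α _ => isSmoothEndOn_Qs_comp_Qa hL hE he hf α.1 α α

theorem isSmoothEndOn_hRen (hL : IsSmoothMetric n ℂ L)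
    (hE : IsSmoothMetric n (EuclideanSpace ℂ (Fin r)) E) (he : ∀ x, ‖e x‖ = 1)
    (hf : IsSmoothEndOn n (EuclideanSpace ℂ (Fin r)) E (fun x => (f x).toLinearMap) Set.univ)
    (hZ : Z.IsHermitian) (hw : Function.Injective w)
    (hZw : ∀ μ : ℂ, Module.End.HasEigenvalue (Matrix.toEuclideanLin Z) μ → ∃ i, μ = (w i : ℂ))
    (t : ℝ) :
    IsSmoothEndOn n (EuclideanSpace ℂ (Fin r)) E (hRen S Z w e f Ψ t) (regLocus S Z w) := by
  refine IsSmoothEndOn.congr (A := fun x => ∑ α : hatSet S Z w e, ∑ β : hatSet S Z w e, ∑ j,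
    ((Real.exp (-((w α : ℝ) - w j) * t) * Real.exp (-((w β : ℝ) - w j) * t) : ℝ) : ℂ) •
      (Qs S Z w e f Ψ j α x ∘ₗ Qa S Z w e f Ψ β j x)) ?_ fun x _ => hRen_eq_sum hZ hw hZw t
  refine IsSmoothEndOn.sum _ fun α _ => IsSmoothEndOn.sum _ fun β _ =>
    IsSmoothEndOn.sum _ fun j _ => ?_
  exact (isSmoothEndOn_Qs_comp_Qa hL hE he hf j α β).const_smul _

/-- In the error term one of the two exponents is at least a gap between two weights, and the other
one is nonnegative. -/
theorem norm_exp_mul_exp_le (hw : StrictAnti w) {δ : ℝ}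
    (hδ : ∀ i j : Fin ν, i < j → δ ≤ (w i : ℝ) - w j) {α β j : Fin ν} (hαj : α ≤ j) (hβj : β ≤ j)
    (h : α < j ∨ β < j) {t : ℝ} (ht : 0 ≤ t) :
    ‖((Real.exp (-((w α : ℝ) - w j) * t) * Real.exp (-((w β : ℝ) - w j) * t) : ℝ) : ℂ)‖
      ≤ Real.exp (-δ * t) := by
  have hnn : ∀ {i : Fin ν}, i ≤ j → (0 : ℝ) ≤ (w i : ℝ) - w j := fun hi =>
    sub_nonneg.2 (by exact_mod_cast hw.antitone hi)
  rw [Complex.norm_real, Real.norm_of_nonneg (by positivity), ← Real.exp_add, ← add_mul]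
  refine Real.exp_le_exp.2 (mul_le_mul_of_nonneg_right ?_ ht)
  have h1 := hnn hαj
  have h2 := hnn hβj
  rcases h with h | h
  · linarith [hδ α j h]
  · linarith [hδ β j h]

theorem decaysOn_errTerm (hL : IsSmoothMetric n ℂ L)
    (hE : IsSmoothMetric n (EuclideanSpace ℂ (Fin r)) E) (he : ∀ x, ‖e x‖ = 1)
    (hf : IsSmoothEndOn n (EuclideanSpace ℂ (Fin r)) E (fun x => (f x).toLinearMap) Set.univ)
    (hw : StrictAnti w) {δ : ℝ} (hδ : ∀ i j : Fin ν, i < j → δ ≤ (w i : ℝ) - w j) {W : Set X}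
    (hW : IsOpen W) (hWreg : W ⊆ regLocus S Z w) {u v : ∀ x, E x}
    (hu : IsSmoothOn n (EuclideanSpace ℂ (Fin r)) E u W)
    (hv : IsSmoothOn n (EuclideanSpace ℂ (Fin r)) E v W) :
    DecaysOn n δ (fun t x => inner ℂ (u x) (errTerm S Z w e f Ψ t x (v x))) W := by
  simp only [errTerm, Finset.sum_sigma', LinearMap.sum_apply, LinearMap.smul_apply, inner_sum,
    inner_smul_right]
  refine decaysOn_sum_mul _ (fun i _ x hx => ?_) fun i hi t ht => ?_
  · exact (hE W hW _ _ hu (isSmoothEndOn_Qs_comp_Qa hL hE he hf i.2.2 i.1 i.2.1 W hW hWreg v hv) x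
      hx).contMDiffAt (hW.mem_nhds hx)
  · simp only [Finset.mem_sigma, Finset.mem_filter, Finset.mem_univ, true_and] at hi
    exact norm_exp_mul_exp_le hw hδ hi.1.1 hi.1.2 hi.2 ht

theorem tendsto_errTerm (hw : StrictAnti w) (x : X) (u : E x) :
    Tendsto (fun t : ℝ => errTerm S Z w e f Ψ t x u) atTop (𝓝 0) := by
  have h0 : (0 : E x) = ∑ α : hatSet S Z w e, ∑ β : hatSet S Z w e,
    ∑ j ∈ Finset.univ.filter (fun j : Fin ν => (α.1 ≤ j ∧ β.1 ≤ j) ∧ (α.1 < j ∨ β.1 < j)),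
      ((0 : ℝ) : ℂ) • (Qs S Z w e f Ψ j α x ∘ₗ Qa S Z w e f Ψ β j x) u := by simp
  rw [h0]
  simp only [errTerm, LinearMap.sum_apply, LinearMap.smul_apply]
  refine tendsto_finsetSum _ fun α _ => tendsto_finsetSum _ fun β _ =>
    tendsto_finsetSum _ fun j hj => Tendsto.smul_const ?_ _
  refine (Complex.continuous_ofReal.tendsto 0).comp ?_
  obtain ⟨⟨hα, hβ⟩, h⟩ := (Finset.mem_filter.1 hj).2
  have hlt : ∀ {i : Fin ν}, i < j → (0 : ℝ) < (w i : ℝ) - w j := fun hi =>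
    sub_pos.2 (by exact_mod_cast hw hi)
  have hle : ∀ {i : Fin ν}, i ≤ j → (0 : ℝ) ≤ (w i : ℝ) - w j := fun hi =>
    sub_nonneg.2 (by exact_mod_cast hw.antitone hi)
  have hpos : 0 < ((w α : ℝ) - w j) + ((w β : ℝ) - w j) := by
    rcases h with h | h
    · exact add_pos_of_pos_of_nonneg (hlt h) (hle hβ)
    · exact add_pos_of_nonneg_of_pos (hle hα) (hlt h)
  have hlim := Real.tendsto_exp_neg_atTop_nhds_zero.comp (tendsto_id.const_mul_atTop hpos)
  refine hlim.congr fun t => ?_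
  rw [← Real.exp_add, Function.comp_apply]
  congr 1
  simp only [id]
  ring

end SmoothBlocks

end QuotFS

theorem mainTheorem6
    -- a compact connected complex manifold with a very ample line bundle
    {n : ℕ} {X : Type u} [TopologicalSpace X] [T2Space X] [CompactSpace X] [ConnectedSpace X]
    [ChartedSpace (EuclideanSpace ℂ (Fin n)) X]
    [IsManifold 𝓘(ℂ, EuclideanSpace ℂ (Fin n)) ω X]
    (L : X → Type u) [TopologicalSpace (TotalSpace ℂ L)]
    [∀ x, NormedAddCommGroup (L x)] [∀ x, InnerProductSpace ℂ (L x)]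
    [FiberBundle ℂ L] [VectorBundle ℂ ℂ L]
    [ContMDiffVectorBundle ω ℂ L 𝓘(ℂ, EuclideanSpace ℂ (Fin n))]
    (hL : QuotFS.VeryAmple n L) (hLmetric : QuotFS.IsSmoothMetric n ℂ L)
    -- a holomorphic vector bundle of rank `r` with a reference hermitian metric
    {r : ℕ} (E : X → Type u) [TopologicalSpace (TotalSpace (EuclideanSpace ℂ (Fin r)) E)]
    [∀ x, NormedAddCommGroup (E x)] [∀ x, InnerProductSpace ℂ (E x)]
    [∀ x, FiniteDimensional ℂ (E x)]
    [FiberBundle (EuclideanSpace ℂ (Fin r)) E] [VectorBundle ℂ (EuclideanSpace ℂ (Fin r)) E]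
    [ContMDiffVectorBundle ω (EuclideanSpace ℂ (Fin r)) E 𝓘(ℂ, EuclideanSpace ℂ (Fin n))]
    (hEmetric : QuotFS.IsSmoothMetric n (EuclideanSpace ℂ (Fin r)) E)
    (k : ℤ) (hk : QuotFS.IsRegular n r E L k)
    -- a basis of `H⁰(E(k))`, unit vectors in the fibres of `L`, and the gauge transformation in `Q`
    {N : ℕ} (S : Module.Basis (Fin N) ℂ (QuotFS.H0 n r E L k))
    (e : ∀ x, L x) (he : ∀ x, ‖e x‖ = 1)
    (f : ∀ x, E x ≃ₗ[ℂ] E x)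
    (hf : QuotFS.IsSmoothEndOn n (EuclideanSpace ℂ (Fin r)) E (fun x => (f x).toLinearMap) Set.univ)
    -- the hermitian generator with its weights `w 0 > w 1 > ⋯`
    (ζ : Module.End ℂ (Module.Dual ℂ (QuotFS.H0 n r E L k)))
    (hζ : (LinearMap.toMatrix S.dualBasis S.dualBasis ζ).IsHermitian)
    (hζtr : LinearMap.trace ℂ _ ζ = 0)
    {ν : ℕ} (w : Fin ν → ℚ) (hw : StrictAnti w)
    (hζw : ∀ μ : ℂ, Module.End.HasEigenvalue ζ μ ↔ ∃ i, μ = (w i : ℂ))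
    (Z : Matrix (Fin N) (Fin N) ℂ) (hZ : Z = QuotFS.weightMatrix S ζ)
    -- the `C^∞` splitting of the filtration over the regular locus
    (Ψ : QuotFS.Splitting S Z w e) :
    (∀ x ∈ QuotFS.regLocus S Z w,
      -- `h_{σ_t} = e^{wt} ĥ_{σ_t} e^{wt}`
      (∀ t : ℝ, QuotFS.hFS S Z e f t x =
        QuotFS.weightGauge S Z w e f Ψ t x ∘ₗ QuotFS.hRen S Z w e f Ψ t x ∘ₗ
          LinearMap.adjoint (QuotFS.weightGauge S Z w e f Ψ t x)) ∧
      -- `ĥ_{σ_t}` is the block-diagonal form plus the error term, which is hermitian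
      (∀ t : ℝ, QuotFS.hRen S Z w e f Ψ t x =
        QuotFS.hLim S Z w e f Ψ x + QuotFS.errTerm S Z w e f Ψ t x) ∧
      (∀ t : ℝ, (QuotFS.errTerm S Z w e f Ψ t x).IsSymmetric) ∧
      -- convergence to a positive definite hermitian form
      (∀ u : E x, Tendsto (fun t : ℝ => QuotFS.hRen S Z w e f Ψ t x u) atTop
        (𝓝 (QuotFS.hLim S Z w e f Ψ x u))) ∧
      (QuotFS.hLim S Z w e f Ψ x).IsSymmetric ∧
      (∀ u : E x, u ≠ 0 → 0 < (inner ℂ (QuotFS.hLim S Z w e f Ψ x u) u).re)) ∧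
    -- the forms are `C^∞` over the regular locus
    (∀ t : ℝ, QuotFS.IsSmoothEndOn n (EuclideanSpace ℂ (Fin r)) E
      (QuotFS.hRen S Z w e f Ψ t) (QuotFS.regLocus S Z w)) ∧
    QuotFS.IsSmoothEndOn n (EuclideanSpace ℂ (Fin r)) E
      (QuotFS.hLim S Z w e f Ψ) (QuotFS.regLocus S Z w) ∧
    -- the error term `ĥ_{σ_t} - ĥ` decays exponentially, locally uniformly with all derivatives;
    -- the rate is the smallest gap between the weights
    (∀ δ : ℝ, (∀ i j : Fin ν, i < j → δ ≤ (w i : ℝ) - w j) →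
      ∀ W : Set X, IsOpen W → W ⊆ QuotFS.regLocus S Z w →
      ∀ u v : ∀ x, E x, QuotFS.IsSmoothOn n (EuclideanSpace ℂ (Fin r)) E u W →
        QuotFS.IsSmoothOn n (EuclideanSpace ℂ (Fin r)) E v W →
        QuotFS.DecaysOn n δ
          (fun t x => inner ℂ (u x) (QuotFS.errTerm S Z w e f Ψ t x (v x))) W) := by
  subst hZ
  have hZ := QuotFS.isHermitian_weightMatrix S hζ
  have hZw : ∀ μ : ℂ, Module.End.HasEigenvalue
      (Matrix.toEuclideanLin (QuotFS.weightMatrix S ζ)) μ → ∃ i, μ = (w i : ℂ) := fun μ hμ =>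
    (hζw μ).1 ((QuotFS.hasEigenvalue_weightMatrix_iff S hζ μ).1 hμ)
  refine ⟨fun x hx => ?_, fun t => QuotFS.isSmoothEndOn_hRen hLmetric hEmetric he hf hZ hw.injective
    hZw t, QuotFS.isSmoothEndOn_hLim hLmetric hEmetric he hf, fun δ hδ W hW hWreg u v hu hv =>
    QuotFS.decaysOn_errTerm hLmetric hEmetric he hf hw hδ hW hWreg hu hv⟩
  have hdec := QuotFS.hRen_eq_hLim_add_errTerm (f := f) (Ψ := Ψ) hx hZ hw.injective hZw
  refine ⟨fun t => QuotFS.hFS_eq_weightGauge_comp_hRen hx t, hdec, fun t => ?_, fun u => ?_,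
    QuotFS.isSymmetric_hLim, fun u hu => QuotFS.hLim_posDef hx hu⟩
  · rw [← sub_eq_of_eq_add' (hdec t)]
    exact QuotFS.isSymmetric_hRen t |>.sub QuotFS.isSymmetric_hLim
  · simp only [hdec, LinearMap.add_apply]
    simpa using (QuotFS.tendsto_errTerm hw x u).const_add (QuotFS.hLim S _ w e f Ψ x u)
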